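/- Let $n,m\ge 0$ and $d\ge 1$ be integers, let $A,\bar A,Q\in\mathbb R^{n\times n}$, $B,\bar B\in\mathbb R^{n\times m}$, $R\in\mathbb R^{m\times m}$ with $Q\ge 0$ and $R>0$ symmetric, and let $(w_k)_{k\ge 0}$ be square-integrable real random variables on a probability space with $\mathcal F_t=\sigma(w_0,\dots,w_t)$ ($\mathcal F_t$ trivial for $t<0$), $\mathsf E[w_k\mid\mathcal F_{k-1}]=0$ and $\mathsf E[w_k^2\mid\mathcal F_{k-1}]=1$ for all $k$ (for example independent, with mean $0$ and variance $1$). For initial data $x_0\in\mathbb R^n$, $u_{-d},\dots,u_{-1}\in\mathbb R^m$ and a control $(u_k)_{k\ge0}$, consider $$x_{k+1}=(A+w_k\bar A)x_k+(B+w_k\bar B)u_{k-d},\qquad J=\mathsf E\sum_{k=0}^\infty\bigl(x_k'Qx_k+u_{k-d}'Ru_{k-d}\bigr)\in[0,\infty].$$ A control is a sequence of square-integrable $u_k$ that are $\mathcal F_{k-1}$-measurable; it is admissible (for the given initial data) if $\lim_{k\to\infty}\mathsf E[x_k'x_k]=0$. It is optimal if it is admissible, $J<\infty$, and it minimizes $J$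 among all admissible controls. The problem is uniquely solvable if for all initial data there is an optimal control, unique up to almost sure equality. Write $x_k|_t=\mathsf E[x_k\mid\mathcal F_t]$ and $x_k|_{s}^{t}=x_k|_t-x_k|_s$. Suppose that $(A,\bar A\,|\,Q^{1/2})$ is exactly observable, i.e. if $z_0\in\mathbb R^n$ is deterministic, $z_{k+1}=(A+w_k\bar A)z_k$, and $Q^{1/2}z_k=0$ almost surely for all $k\ge0$, then $z_0=0$. Then the problem is uniquely solvable if and only if the equations $$P^{i-1}=A'P^iA+\bar A'P^0\bar A+Q,\quad i=1,\dots,d,$$ $$P^d=(A-BK)'P^d(A-BK)+(\bar A-\bar BK)'P^0(\bar A-\bar BK)+K'RK+Q,$$ $$K=(R+B'P^dB+\bar B'P^0\bar B)^{-1}(B'P^dA+\bar B'P^0\bar A)$$ have exactly one solution $P^0,\dots,P^d$ consisting of (symmetric) positive definite matrices. Moreover, if $P^0,\dots,P^d$ is a positive definite solution, then for all initial data a control is optimal if and only if $u_{k-d}=-K\,x_k|_{k-d-1}$ almost surely for all $k\ge d$; and for every control $u$ and every $k\ge d$, the value function at time $k$, that is, the infimum of $\mathsf E\sum_{j\ge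 k}(x_j'Qx_j+v_{j-d}'Rv_{j-d})$ over all admissible controls $v$ with $v_j=u_j$ for $0\le j<k-d$ (where $x$ in the sum is the trajectory of $v$), is finite and equals $$V_k=\mathsf E\Bigl[x_k'\Bigl(P^d\,x_k|_{k-d-1}+\sum_{i=1}^{d}P^{i-1}\,x_k|_{k-i-1}^{k-i}\Bigr)\Bigr],$$ where $x$ is the trajectory of $u$. -/

import Mathlib

open MeasureTheory Filter Topology Matrix
open scoped ENNReal MatrixOrder

noncomputable section

/-- The `σ`-algebra `F_t = σ(w_0, …, w_t)`; it is trivial for `t < 0`. -/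
abbrev noiseAlg {Ω : Type*} (w : ℕ → Ω → ℝ) (t : ℤ) : MeasurableSpace Ω :=
  ⨆ i : ℕ, ⨆ _ : (i : ℤ) ≤ t, MeasurableSpace.comap (w i) inferInstance

/-- Scalar white noise with zero mean and unit variance: given its past, each `w_k` has mean `0`
and second moment `1`. Independent `w_k` with mean `0` and variance `1` are a special case, and
`E[w_k w_s] = δ_{ks}` follows. -/
structure IsWhiteNoise {Ω : Type*} [MeasurableSpace Ω] (μ : Measure Ω) (w : ℕ → Ω → ℝ) :
    Prop where
  measurable : ∀ k, Measurable (w k)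
  memLp : ∀ k, MemLp (w k) 2 μ
  mean_zero : ∀ k : ℕ, μ[w k | noiseAlg w ((k : ℤ) - 1)] =ᵐ[μ] fun _ => 0
  variance_one : ∀ k : ℕ, μ[fun ω => w k ω ^ 2 | noiseAlg w ((k : ℤ) - 1)] =ᵐ[μ] fun _ => 1

/-- The matrices of the problem: `x_{k+1} = (A + w_k Abar) x_k + (B + w_k Bbar) u_{k-d}`
with stage cost `x_k' Q x_k + u_{k-d}' R u_{k-d}`. -/
structure LQRData (n m : ℕ) where
  A : Matrix (Fin n) (Fin n) ℝ
  Abar : Matrix (Fin n) (Fin n) ℝ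
  B : Matrix (Fin n) (Fin m) ℝ
  Bbar : Matrix (Fin n) (Fin m) ℝ
  Q : Matrix (Fin n) (Fin n) ℝ
  R : Matrix (Fin m) (Fin m) ℝ

namespace LQRData

variable {n m d : ℕ} {Ω : Type*}

/-- The uncontrolled trajectory `x_{k+1} = (A + w_k Abar) x_k` started at `x_0 = c`. -/
def freeState (S : LQRData n m) (w : ℕ → Ω → ℝ) (c : Fin n → ℝ) : ℕ → Ω → Fin n → ℝ
  | 0 => fun _ => c
  | k + 1 => fun ω => (S.A + w k ω • S.Abar) *ᵥ S.freeState w c k ω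

/-- Exact observability of `(A, Abar | Q^{1/2})`: if the output `y_k = Q^{1/2} x_k` of the
uncontrolled system vanishes almost surely at all times, then the initial state is zero. -/
def ExactlyObservable [MeasurableSpace Ω] (S : LQRData n m) (μ : Measure Ω) (w : ℕ → Ω → ℝ) :
    Prop :=
  ∀ c : Fin n → ℝ,
    (∀ k, ∀ᵐ ω ∂μ, CFC.sqrt S.Q *ᵥ S.freeState w c k ω = 0) → c = 0

/-- The delayed input `u_{k-d}` acting at time `k`: the prescribed initial input
`u0 k = u_{k-d}` if `k < d`, and the control `u` at time `k - d` otherwise. -/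
def delayedInput (u0 : Fin d → Fin m → ℝ) (u : ℕ → Ω → Fin m → ℝ) (k : ℕ) : Ω → Fin m → ℝ :=
  if h : k < d then fun _ => u0 ⟨k, h⟩ else u (k - d)

/-- The trajectory `x_{k+1} = (A + w_k Abar) x_k + (B + w_k Bbar) u_{k-d}` with initial data
`x_0` and `u_{-d}, …, u_{-1}`. -/
def state (S : LQRData n m) (w : ℕ → Ω → ℝ) (x0 : Fin n → ℝ) (u0 : Fin d → Fin m → ℝ)
    (u : ℕ → Ω → Fin m → ℝ) : ℕ → Ω → Fin n → ℝ
  | 0 => fun _ => x0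
  | k + 1 => fun ω => (S.A + w k ω • S.Abar) *ᵥ S.state w x0 u0 u k ω
      + (S.B + w k ω • S.Bbar) *ᵥ delayedInput u0 u k ω

/-- The expected stage cost `E[x_k' Q x_k + u_{k-d}' R u_{k-d}]`, in `[0, ∞]`. -/
def stageCost [MeasurableSpace Ω] (S : LQRData n m) (μ : Measure Ω) (w : ℕ → Ω → ℝ)
    (x0 : Fin n → ℝ) (u0 : Fin d → Fin m → ℝ) (u : ℕ → Ω → Fin m → ℝ) (k : ℕ) : ℝ≥0∞ :=
  ∫⁻ ω, ENNReal.ofReal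
    (S.state w x0 u0 u k ω ⬝ᵥ S.Q *ᵥ S.state w x0 u0 u k ω
      + delayedInput u0 u k ω ⬝ᵥ S.R *ᵥ delayedInput u0 u k ω) ∂μ

/-- The cost incurred from time `k` on. -/
def costFrom [MeasurableSpace Ω] (S : LQRData n m) (μ : Measure Ω) (w : ℕ → Ω → ℝ)
    (x0 : Fin n → ℝ) (u0 : Fin d → Fin m → ℝ) (u : ℕ → Ω → Fin m → ℝ) (k : ℕ) : ℝ≥0∞ :=
  ∑' j : ℕ, S.stageCost μ w x0 u0 u (k + j)

/-- The performance index `J`. -/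
def cost [MeasurableSpace Ω] (S : LQRData n m) (μ : Measure Ω) (w : ℕ → Ω → ℝ)
    (x0 : Fin n → ℝ) (u0 : Fin d → Fin m → ℝ) (u : ℕ → Ω → Fin m → ℝ) : ℝ≥0∞ :=
  S.costFrom μ w x0 u0 u 0

/-- Each `u_k` is square integrable and `F_{k-1}`-measurable
(so `u_{k-d}` is `F_{k-d-1}`-measurable). -/
def IsControl [MeasurableSpace Ω] (μ : Measure Ω) (w : ℕ → Ω → ℝ)
    (u : ℕ → Ω → Fin m → ℝ) : Prop :=
  ∀ k : ℕ, Measurable[noiseAlg w ((k : ℤ) - 1)] (u k) ∧ MemLp (u k) 2 μ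

/-- A control is admissible if it is moreover mean-square stabilizing. -/
def Admissible [MeasurableSpace Ω] (S : LQRData n m) (μ : Measure Ω) (w : ℕ → Ω → ℝ)
    (x0 : Fin n → ℝ) (u0 : Fin d → Fin m → ℝ) (u : ℕ → Ω → Fin m → ℝ) : Prop :=
  IsControl μ w u ∧
    Tendsto (fun k => ∫ ω, S.state w x0 u0 u k ω ⬝ᵥ S.state w x0 u0 u k ω ∂μ) atTop (𝓝 0)

/-- An admissible control that attains the (finite) minimum of `J`. -/
def IsOptimal [MeasurableSpace Ω] (S : LQRData n m) (μ : Measure Ω) (w : ℕ → Ω → ℝ)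
    (x0 : Fin n → ℝ) (u0 : Fin d → Fin m → ℝ) (u : ℕ → Ω → Fin m → ℝ) : Prop :=
  S.Admissible μ w x0 u0 u ∧ S.cost μ w x0 u0 u ≠ ∞ ∧
    ∀ v, S.Admissible μ w x0 u0 v → S.cost μ w x0 u0 u ≤ S.cost μ w x0 u0 v

/-- For all initial data `x_0, u_{-d}, …, u_{-1}` there is exactly one optimal control, up to
almost sure equality. -/
def UniquelySolvable [MeasurableSpace Ω] (S : LQRData n m) (d : ℕ) (μ : Measure Ω)
    (w : ℕ → Ω → ℝ) : Prop :=
  ∀ (x0 : Fin n → ℝ) (u0 : Fin d → Fin m → ℝ),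
    ∃ u, S.IsOptimal μ w x0 u0 u ∧
      ∀ v, S.IsOptimal μ w x0 u0 v → ∀ k, v k =ᵐ[μ] u k

/-- The value function at time `k` after the past of the control `u`: the infimum of the cost from
time `k` on over all admissible controls that agree with `u` as long as the input acts before
time `k`. -/
def valueFunction [MeasurableSpace Ω] (S : LQRData n m) (μ : Measure Ω) (w : ℕ → Ω → ℝ)
    (x0 : Fin n → ℝ) (u0 : Fin d → Fin m → ℝ) (u : ℕ → Ω → Fin m → ℝ) (k : ℕ) : ℝ≥0∞ :=
  ⨅ (v : ℕ → Ω → Fin m → ℝ) (_ : S.Admissible μ w x0 u0 v)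
    (_ : ∀ j, j + d < k → v j = u j), S.costFrom μ w x0 u0 v k

/-- The predictor `x_k|_t = E[x_k | F_t]`. -/
def predictor [MeasurableSpace Ω] (S : LQRData n m) (μ : Measure Ω) (w : ℕ → Ω → ℝ)
    (x0 : Fin n → ℝ) (u0 : Fin d → Fin m → ℝ) (u : ℕ → Ω → Fin m → ℝ) (k : ℕ) (t : ℤ) :
    Ω → Fin n → ℝ :=
  μ[S.state w x0 u0 u k | noiseAlg w t]

/-- `K = (R + B' P^d B + Bbar' P^0 Bbar)⁻¹ (B' P^d A + Bbar' P^0 Abar)`. -/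
def gain (S : LQRData n m) (P : Fin (d + 1) → Matrix (Fin n) (Fin n) ℝ) :
    Matrix (Fin m) (Fin n) ℝ :=
  (S.R + S.Bᵀ * P (Fin.last d) * S.B + S.Bbarᵀ * P 0 * S.Bbar)⁻¹
    * (S.Bᵀ * P (Fin.last d) * S.A + S.Bbarᵀ * P 0 * S.Abar)

/-- `P^0, …, P^d` is a positive definite solution of the Riccati-type equations. -/
structure IsRiccatiSolution (S : LQRData n m) (P : Fin (d + 1) → Matrix (Fin n) (Fin n) ℝ) :
    Prop where
  posDef : ∀ i, (P i).PosDef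
  /-- `P^{i-1} = A' P^i A + Abar' P^0 Abar + Q` for `i = 1, …, d`. -/
  step : ∀ i : Fin d, P i.castSucc = S.Aᵀ * P i.succ * S.A + S.Abarᵀ * P 0 * S.Abar + S.Q
  last : P (Fin.last d) =
    (S.A - S.B * S.gain P)ᵀ * P (Fin.last d) * (S.A - S.B * S.gain P)
      + (S.Abar - S.Bbar * S.gain P)ᵀ * P 0 * (S.Abar - S.Bbar * S.gain P)
      + (S.gain P)ᵀ * S.R * S.gain P + S.Q

/-- `E[x_k' (P^d x_k|_{k-d-1} + ∑_{i=1}^d P^{i-1} (x_k|_{k-i} - x_k|_{k-i-1}))]`;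
below, `i : Fin d` stands for the summation index minus one. -/
def valueFormula [MeasurableSpace Ω] (S : LQRData n m) (μ : Measure Ω) (w : ℕ → Ω → ℝ)
    (P : Fin (d + 1) → Matrix (Fin n) (Fin n) ℝ)
    (x0 : Fin n → ℝ) (u0 : Fin d → Fin m → ℝ) (u : ℕ → Ω → Fin m → ℝ) (k : ℕ) : ℝ :=
  ∫ ω, S.state w x0 u0 u k ω ⬝ᵥ
    (P (Fin.last d) *ᵥ S.predictor μ w x0 u0 u k ((k : ℤ) - d - 1) ω
      + ∑ i : Fin d, P i.castSucc *ᵥ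
          (S.predictor μ w x0 u0 u k ((k : ℤ) - ((i : ℕ) + 1)) ω
            - S.predictor μ w x0 u0 u k ((k : ℤ) - ((i : ℕ) + 1) - 1) ω)) ∂μ

end LQRData

end

/-! Everything rests on one identity. For positive semidefinite weights `P`, let `energy` at time k
be the quadratic functional whose weights act on the estimates x_k|_{k-i-1}, 0 ≤ i ≤ d; conditioning
shows that it equals the formula for V_k. Splitting x_{k+1} into a part known at time k-1 and a part
multiplied by w_k, and completing the square in the acting input, gives (`energy_succ_add_stage`)
energy_{k+1}(P) + stage_k = energy_k(riccatiMap P) + deviation_k(P), where the deviation is a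
positive definite second moment of u_{k-d} + K x_k|_{k-d-1}.

At a fixed point of `riccatiMap` the identity telescopes: the cost of a stabilizing control from
time k on is the energy at k plus the sum of the deviations from k on (`inputCost_eq`). The energy
at k depends only on inputs acting before k, so the feedback law is the minimizer and the energy is
the value. That the feedback stabilizes comes from observability: a finite-horizon Gramian is
positive definite, so finite cost forces E[x_k'x_k] → 0 (`tendsto_of_inputCost_ne_top`).

Uniqueness of the weights (`riccati_unique`): if the inputs acting from time 0 on are all free,
subject to the delayed information, then x'P^d x is the optimal cost from x; if the input acting at
time 0 must vanish, the optimal cost is x'P^{d-1}x. These costs do not refer to P, so they determine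
P^d and P^{d-1}. The equation for i = d then yields Abar'P^0 Abar, and the other equations give the
remaining weights downwards.

Existence (`riccatiIter_bounded`, `exists_fixedPoint_of_bounded`): the Riccati recursion started at
zero increases, and its energies bound finite-horizon costs from below. Finite-cost inputs that
vanish at time 0 exist because d ≥ 1 and the initial inputs may be zero. They bound the iterates of
P^d and P^{d-1}, hence Abar'P^0 Abar, hence all weights. The limit is a positive semidefinite fixed
point, and observability makes it definite. -/

section QuadraticForms

/-! ### Quadratic forms of real matrices. -/

variable {n m : ℕ}

theorem mulVec_dotProduct_mulVec {a b c e : ℕ} (C : Matrix (Fin a) (Fin b) ℝ)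
    (M : Matrix (Fin a) (Fin c) ℝ) (D : Matrix (Fin c) (Fin e) ℝ) (x : Fin b → ℝ)
    (y : Fin e → ℝ) :
    (C *ᵥ x) ⬝ᵥ M *ᵥ (D *ᵥ y) = x ⬝ᵥ (Cᵀ * M * D) *ᵥ y := by
  rw [← mulVec_mulVec, ← mulVec_mulVec, dotProduct_mulVec x, vecMul_transpose]

theorem dotProduct_mulVec_symm {M : Matrix (Fin n) (Fin n) ℝ} (hM : Mᵀ = M) (x y : Fin n → ℝ) :
    x ⬝ᵥ M *ᵥ y = y ⬝ᵥ M *ᵥ x := by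
  rw [dotProduct_mulVec, ← mulVec_transpose, hM, dotProduct_comm]

theorem dotProduct_mulVec_self_add {M : Matrix (Fin n) (Fin n) ℝ} (hM : Mᵀ = M)
    (x y : Fin n → ℝ) :
    (x + y) ⬝ᵥ M *ᵥ (x + y) = x ⬝ᵥ M *ᵥ x + 2 * (x ⬝ᵥ M *ᵥ y) + y ⬝ᵥ M *ᵥ y := by
  rw [mulVec_add, add_dotProduct, dotProduct_add, dotProduct_add, dotProduct_mulVec_symm hM y x]
  ring

theorem dotProduct_mulVec_self_mulVec_add {M : Matrix (Fin n) (Fin n) ℝ} (hM : Mᵀ = M)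
    {a b : ℕ} (A : Matrix (Fin n) (Fin a) ℝ) (B : Matrix (Fin n) (Fin b) ℝ)
    (x : Fin a → ℝ) (u : Fin b → ℝ) :
    (A *ᵥ x + B *ᵥ u) ⬝ᵥ M *ᵥ (A *ᵥ x + B *ᵥ u) =
      x ⬝ᵥ (Aᵀ * M * A) *ᵥ x + 2 * (x ⬝ᵥ (Aᵀ * M * B) *ᵥ u) + u ⬝ᵥ (Bᵀ * M * B) *ᵥ u := by
  rw [dotProduct_mulVec_self_add hM]
  simp only [mulVec_dotProduct_mulVec]

theorem Matrix.PosSemidef.transpose_eq {M : Matrix (Fin n) (Fin n) ℝ} (hM : M.PosSemidef) :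
    Mᵀ = M := by
  simpa using hM.isHermitian.eq

theorem Matrix.PosSemidef.quad_nonneg {M : Matrix (Fin n) (Fin n) ℝ} (hM : M.PosSemidef)
    (x : Fin n → ℝ) : 0 ≤ x ⬝ᵥ M *ᵥ x := by
  simpa using hM.dotProduct_mulVec_nonneg x

theorem Matrix.PosDef.quad_pos {M : Matrix (Fin n) (Fin n) ℝ} (hM : M.PosDef)
    {x : Fin n → ℝ} (hx : x ≠ 0) : 0 < x ⬝ᵥ M *ᵥ x := by
  simpa using hM.dotProduct_mulVec_pos hx

theorem Matrix.PosDef.eq_zero_of_quad_eq_zero {M : Matrix (Fin n) (Fin n) ℝ} (hM : M.PosDef)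
    {x : Fin n → ℝ} (hx : x ⬝ᵥ M *ᵥ x = 0) : x = 0 := by
  by_contra h
  exact (hM.quad_pos h).ne' hx

theorem posSemidef_of_transpose_eq {M : Matrix (Fin n) (Fin n) ℝ} (hM : Mᵀ = M)
    (h : ∀ x, 0 ≤ x ⬝ᵥ M *ᵥ x) : M.PosSemidef := by
  refine PosSemidef.of_dotProduct_mulVec_nonneg (by simpa [IsHermitian] using hM) fun x => ?_
  simpa using h x

theorem posDef_of_transpose_eq {M : Matrix (Fin n) (Fin n) ℝ} (hM : Mᵀ = M)
    (h : ∀ x, x ≠ 0 → 0 < x ⬝ᵥ M *ᵥ x) : M.PosDef := by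
  refine PosDef.of_dotProduct_mulVec_pos (by simpa [IsHermitian] using hM) fun x hx => ?_
  simpa using h x hx

theorem Matrix.PosSemidef.conj_transpose {a : ℕ} {M : Matrix (Fin n) (Fin n) ℝ}
    (hM : M.PosSemidef) (C : Matrix (Fin n) (Fin a) ℝ) : (Cᵀ * M * C).PosSemidef := by
  simpa using hM.conjTranspose_mul_mul_same C

/-- The entries of a symmetric matrix are recovered from its quadratic form. -/
theorem entry_eq_of_transpose_eq {M : Matrix (Fin n) (Fin n) ℝ} (hM : Mᵀ = M) (i j : Fin n) :
    M i j = ((Pi.single i 1 + Pi.single j 1) ⬝ᵥ M *ᵥ (Pi.single i 1 + Pi.single j 1)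
      - Pi.single i 1 ⬝ᵥ M *ᵥ Pi.single i 1 - Pi.single j 1 ⬝ᵥ M *ᵥ Pi.single j 1) / 2 := by
  rw [dotProduct_mulVec_self_add hM]
  simp only [mulVec_single_one, single_dotProduct, col_apply, one_mul]
  ring

theorem eq_of_quad_eq {M N : Matrix (Fin n) (Fin n) ℝ} (hM : Mᵀ = M) (hN : Nᵀ = N)
    (h : ∀ x, x ⬝ᵥ M *ᵥ x = x ⬝ᵥ N *ᵥ x) : M = N := by
  ext i j
  rw [entry_eq_of_transpose_eq hM, entry_eq_of_transpose_eq hN, h, h, h]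

/-- Every quadratic form is dominated by a multiple of a positive definite one. -/
theorem Matrix.PosDef.exists_quad_le {N : Matrix (Fin n) (Fin n) ℝ} (hN : N.PosDef)
    (M : Matrix (Fin n) (Fin n) ℝ) :
    ∃ C, 0 ≤ C ∧ ∀ x, x ⬝ᵥ M *ᵥ x ≤ C * (x ⬝ᵥ N *ᵥ x) := by
  have hcont : ∀ M : Matrix (Fin n) (Fin n) ℝ, Continuous fun x : Fin n → ℝ => x ⬝ᵥ M *ᵥ x :=
    fun M => by fun_prop
  have hcomp : IsCompact (Metric.sphere (0 : Fin n → ℝ) 1) := isCompact_sphere _ _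
  have hne : ∀ x ∈ Metric.sphere (0 : Fin n → ℝ) 1, x ⬝ᵥ N *ᵥ x ≠ 0 := by
    intro x hx
    refine (hN.quad_pos ?_).ne'
    rintro rfl
    simp at hx
  obtain ⟨C, hC⟩ := hcomp.bddAbove_image
    (f := fun x : Fin n → ℝ => (x ⬝ᵥ M *ᵥ x) / (x ⬝ᵥ N *ᵥ x))
    ((hcont M).continuousOn.div (hcont N).continuousOn hne)
  -- The bound `C` can be negative, for instance if the sphere is empty (n = 0) or if `M` is
  -- negative definite.
  refine ⟨max C 0, le_max_right _ _, fun x => ?_⟩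
  rcases eq_or_ne x 0 with rfl | hx
  · simp
  have hx' : 0 < ‖x‖ := norm_pos_iff.2 hx
  have hy : ‖x‖⁻¹ • x ∈ Metric.sphere (0 : Fin n → ℝ) 1 := by
    simp [norm_smul, hx'.ne']
  have h1 := hC ⟨_, hy, rfl⟩
  have hNx := hN.quad_pos hx
  simp only [mulVec_smul, smul_dotProduct, dotProduct_smul, smul_eq_mul] at h1
  rw [mul_div_mul_left _ _ (by positivity), mul_div_mul_left _ _ (by positivity),
    div_le_iff₀ hNx] at h1
  exact h1.trans (mul_le_mul_of_nonneg_right (le_max_left _ _) hNx.le)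

end QuadraticForms

/-! ### The Riccati operator and completion of the square. -/

namespace LQRData

variable {n m d : ℕ}

/-- The weight `R + B' P^d B + Bbar' P^0 Bbar` of the control deviation. -/
def inputWeight (S : LQRData n m) (P : Fin (d + 1) → Matrix (Fin n) (Fin n) ℝ) :
    Matrix (Fin m) (Fin m) ℝ :=
  S.R + S.Bᵀ * P (Fin.last d) * S.B + S.Bbarᵀ * P 0 * S.Bbar

/-- One uncontrolled step `A' M A + Abar' N Abar + Q` of the Riccati recursion. -/
def uncontrolledStep (S : LQRData n m) (M N : Matrix (Fin n) (Fin n) ℝ) :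
    Matrix (Fin n) (Fin n) ℝ :=
  S.Aᵀ * M * S.A + S.Abarᵀ * N * S.Abar + S.Q

/-- One step of the Riccati recursion under the feedback gain `K`. -/
noncomputable def controlledStep (S : LQRData n m) (K : Matrix (Fin m) (Fin n) ℝ)
    (P : Fin (d + 1) → Matrix (Fin n) (Fin n) ℝ) : Matrix (Fin n) (Fin n) ℝ :=
  (S.A - S.B * K)ᵀ * P (Fin.last d) * (S.A - S.B * K)
    + (S.Abar - S.Bbar * K)ᵀ * P 0 * (S.Abar - S.Bbar * K) + Kᵀ * S.R * K + S.Q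

/-- The Riccati operator, whose positive definite fixed points are the solutions. -/
noncomputable def riccatiMap (S : LQRData n m) (P : Fin (d + 1) → Matrix (Fin n) (Fin n) ℝ) :
    Fin (d + 1) → Matrix (Fin n) (Fin n) ℝ :=
  Fin.lastCases (S.controlledStep (S.gain P) P) fun i => S.uncontrolledStep (P i.succ) (P 0)

variable (S : LQRData n m) (P : Fin (d + 1) → Matrix (Fin n) (Fin n) ℝ)

@[simp] theorem riccatiMap_last :
    S.riccatiMap P (Fin.last d) = S.controlledStep (S.gain P) P := by
  simp [riccatiMap]

@[simp] theorem riccatiMap_castSucc (i : Fin d) :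
    S.riccatiMap P i.castSucc = S.uncontrolledStep (P i.succ) (P 0) := by
  simp [riccatiMap]

theorem isRiccatiSolution_iff :
    S.IsRiccatiSolution P ↔ (∀ i, (P i).PosDef) ∧ S.riccatiMap P = P := by
  constructor
  · intro h
    refine ⟨h.posDef, funext fun i => ?_⟩
    induction i using Fin.lastCases with
    | last => rw [riccatiMap_last]; exact h.last.symm
    | cast i => rw [riccatiMap_castSucc]; exact (h.step i).symm
  · rintro ⟨h, hP⟩
    refine ⟨h, fun i => ?_, ?_⟩
    · have := congrFun hP i.castSucc
      rw [riccatiMap_castSucc] at this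
      exact this.symm
    · have := congrFun hP (Fin.last d)
      rw [riccatiMap_last] at this
      exact this.symm

variable {S P}

theorem inputWeight_posDef (hR : S.R.PosDef) (hP : ∀ i, (P i).PosSemidef) :
    (S.inputWeight P).PosDef :=
  (hR.add_posSemidef ((hP _).conj_transpose _)).add_posSemidef ((hP _).conj_transpose _)

/-- The inverse in `gain` is a true inverse, since R > 0 already makes the weight definite.
Semidefinite `P` suffices, so this covers the iterates started at zero. -/
theorem inputWeight_mul_gain (hR : S.R.PosDef) (hP : ∀ i, (P i).PosSemidef) :
    S.inputWeight P * S.gain P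
      = S.Bᵀ * P (Fin.last d) * S.A + S.Bbarᵀ * P 0 * S.Abar := by
  have h : IsUnit (S.inputWeight P).det :=
    (isUnit_iff_isUnit_det _).1 (inputWeight_posDef hR hP).isUnit
  exact mul_nonsing_inv_cancel_left _ _ h

theorem quad_uncontrolledStep (M N : Matrix (Fin n) (Fin n) ℝ) (x : Fin n → ℝ) :
    x ⬝ᵥ S.uncontrolledStep M N *ᵥ x
      = (S.A *ᵥ x) ⬝ᵥ M *ᵥ (S.A *ᵥ x) + (S.Abar *ᵥ x) ⬝ᵥ N *ᵥ (S.Abar *ᵥ x)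
        + x ⬝ᵥ S.Q *ᵥ x := by
  simp only [uncontrolledStep, add_mulVec, dotProduct_add, mulVec_dotProduct_mulVec]

theorem quad_controlledStep (K : Matrix (Fin m) (Fin n) ℝ) (x : Fin n → ℝ) :
    x ⬝ᵥ S.controlledStep K P *ᵥ x
      = (S.A *ᵥ x + S.B *ᵥ (-(K *ᵥ x))) ⬝ᵥ P (Fin.last d) *ᵥ (S.A *ᵥ x + S.B *ᵥ (-(K *ᵥ x)))
        + (S.Abar *ᵥ x + S.Bbar *ᵥ (-(K *ᵥ x))) ⬝ᵥ P 0 *ᵥ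
          (S.Abar *ᵥ x + S.Bbar *ᵥ (-(K *ᵥ x)))
        + (-(K *ᵥ x)) ⬝ᵥ S.R *ᵥ (-(K *ᵥ x)) + x ⬝ᵥ S.Q *ᵥ x := by
  have h1 : S.A *ᵥ x + S.B *ᵥ (-(K *ᵥ x)) = (S.A - S.B * K) *ᵥ x := by
    rw [sub_mulVec, mulVec_neg, mulVec_mulVec, sub_eq_add_neg]
  have h2 : S.Abar *ᵥ x + S.Bbar *ᵥ (-(K *ᵥ x)) = (S.Abar - S.Bbar * K) *ᵥ x := by
    rw [sub_mulVec, mulVec_neg, mulVec_mulVec, sub_eq_add_neg]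
  have h3 : (-(K *ᵥ x)) ⬝ᵥ S.R *ᵥ (-(K *ᵥ x)) = (K *ᵥ x) ⬝ᵥ S.R *ᵥ (K *ᵥ x) := by
    rw [mulVec_neg, neg_dotProduct, dotProduct_neg, neg_neg]
  rw [h1, h2, h3]
  simp only [controlledStep, add_mulVec, dotProduct_add, mulVec_dotProduct_mulVec]

theorem uncontrolledStep_posSemidef (hQ : S.Q.PosSemidef) {M N : Matrix (Fin n) (Fin n) ℝ}
    (hM : M.PosSemidef) (hN : N.PosSemidef) : (S.uncontrolledStep M N).PosSemidef :=
  ((hM.conj_transpose _).add (hN.conj_transpose _)).add hQ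

theorem controlledStep_posSemidef (hQ : S.Q.PosSemidef) (hR : S.R.PosDef)
    (hP : ∀ i, (P i).PosSemidef) (K : Matrix (Fin m) (Fin n) ℝ) :
    (S.controlledStep K P).PosSemidef :=
  ((((hP _).conj_transpose _).add ((hP _).conj_transpose _)).add
    (hR.posSemidef.conj_transpose _)).add hQ

theorem riccatiMap_posSemidef (hQ : S.Q.PosSemidef) (hR : S.R.PosDef)
    (hP : ∀ i, (P i).PosSemidef) (i : Fin (d + 1)) : (S.riccatiMap P i).PosSemidef := by
  induction i using Fin.lastCases with
  | last => rw [riccatiMap_last]; exact controlledStep_posSemidef hQ hR hP _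
  | cast i => rw [riccatiMap_castSucc]; exact uncontrolledStep_posSemidef hQ (hP _) (hP _)

/-- Completing the square, with the remainder in terms of the uncontrolled step. -/
theorem stage_add_quad_eq_uncontrolledStep (hR : S.R.PosDef) (hP : ∀ i, (P i).PosSemidef)
    (x : Fin n → ℝ) (u : Fin m → ℝ) :
    (S.A *ᵥ x + S.B *ᵥ u) ⬝ᵥ P (Fin.last d) *ᵥ (S.A *ᵥ x + S.B *ᵥ u)
        + (S.Abar *ᵥ x + S.Bbar *ᵥ u) ⬝ᵥ P 0 *ᵥ (S.Abar *ᵥ x + S.Bbar *ᵥ u)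
        + u ⬝ᵥ S.R *ᵥ u + x ⬝ᵥ S.Q *ᵥ x
      = x ⬝ᵥ S.uncontrolledStep (P (Fin.last d)) (P 0) *ᵥ x
        - (S.gain P *ᵥ x) ⬝ᵥ S.inputWeight P *ᵥ (S.gain P *ᵥ x)
        + (u + S.gain P *ᵥ x) ⬝ᵥ S.inputWeight P *ᵥ (u + S.gain P *ᵥ x) := by
  -- The equation defining the gain says that the part linear in `u` is the cross term of the
  -- square.
  have hcross : u ⬝ᵥ S.inputWeight P *ᵥ (S.gain P *ᵥ x)
      = x ⬝ᵥ (S.Aᵀ * P (Fin.last d) * S.B) *ᵥ u + x ⬝ᵥ (S.Abarᵀ * P 0 * S.Bbar) *ᵥ u := by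
    rw [mulVec_mulVec, inputWeight_mul_gain hR hP, add_mulVec, dotProduct_add,
      ← mulVec_dotProduct_mulVec, ← mulVec_dotProduct_mulVec, ← mulVec_dotProduct_mulVec,
      ← mulVec_dotProduct_mulVec, dotProduct_mulVec_symm (hP _).transpose_eq,
      dotProduct_mulVec_symm (hP 0).transpose_eq]
  rw [dotProduct_mulVec_self_add (inputWeight_posDef hR hP).posSemidef.transpose_eq, hcross,
    quad_uncontrolledStep, dotProduct_mulVec_self_mulVec_add (hP _).transpose_eq,
    dotProduct_mulVec_self_mulVec_add (hP _).transpose_eq]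
  simp only [mulVec_dotProduct_mulVec, inputWeight, add_mulVec, dotProduct_add]
  ring

theorem quad_controlledStep_gain (hR : S.R.PosDef) (hP : ∀ i, (P i).PosSemidef)
    (x : Fin n → ℝ) :
    x ⬝ᵥ S.controlledStep (S.gain P) P *ᵥ x
      = x ⬝ᵥ S.uncontrolledStep (P (Fin.last d)) (P 0) *ᵥ x
        - (S.gain P *ᵥ x) ⬝ᵥ S.inputWeight P *ᵥ (S.gain P *ᵥ x) := by
  rw [quad_controlledStep, stage_add_quad_eq_uncontrolledStep hR hP]
  simp

/-- Completing the square. -/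
theorem stage_add_quad_eq (hR : S.R.PosDef) (hP : ∀ i, (P i).PosSemidef)
    (x : Fin n → ℝ) (u : Fin m → ℝ) :
    (S.A *ᵥ x + S.B *ᵥ u) ⬝ᵥ P (Fin.last d) *ᵥ (S.A *ᵥ x + S.B *ᵥ u)
        + (S.Abar *ᵥ x + S.Bbar *ᵥ u) ⬝ᵥ P 0 *ᵥ (S.Abar *ᵥ x + S.Bbar *ᵥ u)
        + u ⬝ᵥ S.R *ᵥ u + x ⬝ᵥ S.Q *ᵥ x
      = x ⬝ᵥ S.riccatiMap P (Fin.last d) *ᵥ x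
        + (u + S.gain P *ᵥ x) ⬝ᵥ S.inputWeight P *ᵥ (u + S.gain P *ᵥ x) := by
  rw [stage_add_quad_eq_uncontrolledStep hR hP, riccatiMap_last, quad_controlledStep_gain hR hP]

/-- The feedback gain minimizes the Riccati step. -/
theorem quad_controlledStep_gain_le (hR : S.R.PosDef) (hP : ∀ i, (P i).PosSemidef)
    (K : Matrix (Fin m) (Fin n) ℝ) (x : Fin n → ℝ) :
    x ⬝ᵥ S.controlledStep (S.gain P) P *ᵥ x ≤ x ⬝ᵥ S.controlledStep K P *ᵥ x := by
  rw [quad_controlledStep K, stage_add_quad_eq hR hP, riccatiMap_last]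
  exact le_add_of_nonneg_right ((inputWeight_posDef hR hP).posSemidef.quad_nonneg _)

/-- The Riccati operator is monotone. -/
theorem riccatiMap_mono (hR : S.R.PosDef) {P P' : Fin (d + 1) → Matrix (Fin n) (Fin n) ℝ}
    (hP : ∀ i, (P i).PosSemidef) (h : ∀ i x, x ⬝ᵥ P i *ᵥ x ≤ x ⬝ᵥ P' i *ᵥ x)
    (i : Fin (d + 1)) (x : Fin n → ℝ) :
    x ⬝ᵥ S.riccatiMap P i *ᵥ x ≤ x ⬝ᵥ S.riccatiMap P' i *ᵥ x := by
  induction i using Fin.lastCases with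
  | last =>
    rw [riccatiMap_last, riccatiMap_last]
    -- The gain of `P'` is suboptimal for `P`; with the gain frozen, the step is visibly monotone in
    -- the weights.
    refine (quad_controlledStep_gain_le hR hP (S.gain P') x).trans ?_
    rw [quad_controlledStep, quad_controlledStep]
    gcongr <;> exact h _ _
  | cast i =>
    rw [riccatiMap_castSucc, riccatiMap_castSucc, quad_uncontrolledStep, quad_uncontrolledStep]
    gcongr <;> exact h _ _

/-- The weight `P^{d-1}` after one Riccati step exceeds `P^d` by the cost of forgoing the
feedback once. -/
theorem quad_riccatiMap_pred_last (hR : S.R.PosDef)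
    {P : Fin (d + 1 + 1) → Matrix (Fin n) (Fin n) ℝ} (hP : ∀ i, (P i).PosSemidef)
    (x : Fin n → ℝ) :
    x ⬝ᵥ S.riccatiMap P (Fin.last d).castSucc *ᵥ x
      = x ⬝ᵥ S.riccatiMap P (Fin.last (d + 1)) *ᵥ x
        + (S.gain P *ᵥ x) ⬝ᵥ S.inputWeight P *ᵥ (S.gain P *ᵥ x) := by
  rw [riccatiMap_castSucc, riccatiMap_last, quad_controlledStep_gain hR hP, Fin.succ_last]
  ring

end LQRData

/-! ### Conditional moments of the noise. -/

section NoiseFiltration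

variable {Ω : Type*} {w : ℕ → Ω → ℝ}

theorem noiseAlg_mono {s t : ℤ} (h : s ≤ t) : noiseAlg w s ≤ noiseAlg w t :=
  iSup_mono fun _ => iSup_mono' fun hi => ⟨hi.trans h, le_rfl⟩

theorem measurable_noiseAlg {k : ℕ} {t : ℤ} (h : (k : ℤ) ≤ t) :
    Measurable[noiseAlg w t] (w k) := by
  refine Measurable.mono (comap_measurable (w k)) ?_ le_rfl
  exact le_iSup_of_le k (le_iSup_of_le h le_rfl)

variable [MeasurableSpace Ω] {μ : Measure Ω}

theorem IsWhiteNoise.noiseAlg_le (hw : IsWhiteNoise μ w) (t : ℤ) :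
    noiseAlg w t ≤ ‹MeasurableSpace Ω› :=
  iSup_le fun i => iSup_le fun _ => (hw.measurable i).comap_le

/-- The noise `w_k` preserves the expected square of nonnegative functions of the past. -/
theorem IsWhiteNoise.lintegral_sq_mul [IsProbabilityMeasure μ] (hw : IsWhiteNoise μ w) (k : ℕ)
    {g : Ω → ℝ≥0∞} (hg : Measurable[noiseAlg w ((k : ℤ) - 1)] g) :
    ∫⁻ ω, ENNReal.ofReal (w k ω ^ 2) * g ω ∂μ = ∫⁻ ω, g ω ∂μ := by
  have hle := hw.noiseAlg_le ((k : ℤ) - 1)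
  have hmeas : Measurable fun ω => ENNReal.ofReal (w k ω ^ 2) :=
    ((hw.measurable k).pow_const 2).ennreal_ofReal
  have hint : Integrable (fun ω => w k ω ^ 2) μ := (hw.memLp k).integrable_sq
  -- It is enough that `μ` and its reweighting by w_k² agree on the past σ-algebra. There the
  -- variance condition is tested on sets, so `g` need not be integrable.
  have htrim : (μ.withDensity fun ω => ENNReal.ofReal (w k ω ^ 2)).trim hle = μ.trim hle := by
    refine @Measure.ext _ (noiseAlg w ((k : ℤ) - 1)) _ _ fun s hs => ?_
    rw [trim_measurableSet_eq hle hs, trim_measurableSet_eq hle hs,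
      withDensity_apply _ (hle s hs),
      ← ofReal_integral_eq_lintegral_ofReal hint.integrableOn (ae_of_all _ fun _ => sq_nonneg _),
      ← setIntegral_condExp hle hint hs,
      setIntegral_congr_ae (g := fun _ => (1 : ℝ)) (hle s hs)
        ((hw.variance_one k).mono fun _ h _ => h)]
    simp
  have h1 := lintegral_withDensity_eq_lintegral_mul μ hmeas (hg.mono hle le_rfl)
  simp only [Pi.mul_apply] at h1
  rw [← h1, ← lintegral_trim hle hg, htrim, lintegral_trim hle hg]

/-- A product of two L² functions is only in L¹ in general; it is in L² here because multiplication
by `w k` is an L² isometry on functions of the past. -/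
theorem IsWhiteNoise.memLp_mul [IsProbabilityMeasure μ] (hw : IsWhiteNoise μ w) (k : ℕ)
    {g : Ω → ℝ} (hg : Measurable[noiseAlg w ((k : ℤ) - 1)] g) (hg2 : MemLp g 2 μ) :
    MemLp (fun ω => w k ω * g ω) 2 μ := by
  have hle := hw.noiseAlg_le ((k : ℤ) - 1)
  have hmeas : Measurable fun ω => w k ω * g ω := (hw.measurable k).mul (hg.mono hle le_rfl)
  rw [memLp_two_iff_integrable_sq hmeas.aestronglyMeasurable]
  refine ⟨(hmeas.pow_const 2).aestronglyMeasurable, ?_⟩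
  rw [hasFiniteIntegral_iff_ofReal (ae_of_all _ fun _ => sq_nonneg _)]
  have h : ∀ ω, ENNReal.ofReal ((w k ω * g ω) ^ 2)
      = ENNReal.ofReal (w k ω ^ 2) * ENNReal.ofReal (g ω ^ 2) := fun ω => by
    rw [mul_pow, ENNReal.ofReal_mul (sq_nonneg _)]
  simp only [h]
  rw [hw.lintegral_sq_mul k (g := fun ω => ENNReal.ofReal (g ω ^ 2))
    (ENNReal.measurable_ofReal.comp (hg.pow_const 2)),
    ← hasFiniteIntegral_iff_ofReal (ae_of_all _ fun _ => sq_nonneg _)]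
  exact hg2.integrable_sq.2

theorem IsWhiteNoise.memLp_smul [IsProbabilityMeasure μ] (hw : IsWhiteNoise μ w) (k : ℕ) {n : ℕ}
    {Z : Ω → Fin n → ℝ} (hZ : Measurable[noiseAlg w ((k : ℤ) - 1)] Z) (hZ2 : MemLp Z 2 μ) :
    MemLp (fun ω => w k ω • Z ω) 2 μ :=
  MemLp.of_eval fun i => hw.memLp_mul k ((measurable_pi_apply i).comp hZ) (hZ2.eval i)

theorem IsWhiteNoise.condExp_smul [IsProbabilityMeasure μ] (hw : IsWhiteNoise μ w) (k : ℕ) {n : ℕ}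
    {Z : Ω → Fin n → ℝ} (hZ : Measurable[noiseAlg w ((k : ℤ) - 1)] Z) (hZ2 : MemLp Z 2 μ) {t : ℤ}
    (ht : t < k) : μ[fun ω => w k ω • Z ω | noiseAlg w t] =ᵐ[μ] 0 := by
  have hle := hw.noiseAlg_le ((k : ℤ) - 1)
  have hint := (hw.memLp_smul k hZ hZ2).integrable one_le_two
  have h1 : μ[fun ω => w k ω • Z ω | noiseAlg w ((k : ℤ) - 1)] =ᵐ[μ] 0 := by
    refine (condExp_smul_of_aestronglyMeasurable_right (f := w k)
      ((hw.memLp k).integrable one_le_two) hint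
      hZ.stronglyMeasurable.aestronglyMeasurable).trans ?_
    filter_upwards [hw.mean_zero k] with ω hω
    simp [hω]
  refine (condExp_condExp_of_le (noiseAlg_mono (Int.le_sub_one_of_lt ht)) hle).symm.trans ?_
  refine (condExp_congr_ae h1).trans ?_
  rw [condExp_zero]

theorem IsWhiteNoise.integral_sq_mul [IsProbabilityMeasure μ] (hw : IsWhiteNoise μ w) (k : ℕ)
    {g : Ω → ℝ} (hg : Measurable[noiseAlg w ((k : ℤ) - 1)] g)
    (hint : Integrable (fun ω => w k ω ^ 2 * g ω) μ) :
    ∫ ω, w k ω ^ 2 * g ω ∂μ = ∫ ω, g ω ∂μ := by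
  have hle := hw.noiseAlg_le ((k : ℤ) - 1)
  rw [← integral_condExp hle]
  refine integral_congr_ae ?_
  refine (condExp_mul_of_stronglyMeasurable_right (f := fun ω => w k ω ^ 2) hg.stronglyMeasurable
    hint (hw.memLp k).integrable_sq).trans ?_
  filter_upwards [hw.variance_one k] with ω hω
  simp [hω]

end NoiseFiltration

/-! ### Second moments of random vectors and conditioning. -/

section SecondMoment

variable {Ω : Type*} {F mΩ : MeasurableSpace Ω} {μ : Measure Ω} {a b c e : ℕ}

/-- The second moment `E[X' M Y]`. -/
noncomputable def secondMoment (μ : Measure Ω) (M : Matrix (Fin a) (Fin b) ℝ)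
    (X : Ω → Fin a → ℝ) (Y : Ω → Fin b → ℝ) : ℝ :=
  ∫ ω, X ω ⬝ᵥ M *ᵥ Y ω ∂μ

theorem MeasureTheory.MemLp.mulVec {X : Ω → Fin b → ℝ} (hX : MemLp X 2 μ)
    (M : Matrix (Fin a) (Fin b) ℝ) : MemLp (fun ω => M *ᵥ X ω) 2 μ :=
  (LinearMap.toContinuousLinearMap M.mulVecLin).comp_memLp' hX

theorem MeasureTheory.MemLp.integrable_bilin {X : Ω → Fin a → ℝ} {Y : Ω → Fin b → ℝ}
    (hX : MemLp X 2 μ) (hY : MemLp Y 2 μ) (M : Matrix (Fin a) (Fin b) ℝ) :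
    Integrable (fun ω => X ω ⬝ᵥ M *ᵥ Y ω) μ :=
  integrable_finsetSum _ fun i _ => (hX.eval i).integrable_mul ((hY.mulVec M).eval i)

theorem condExp_mulVec [IsFiniteMeasure μ] {X : Ω → Fin b → ℝ} (hX : Integrable X μ)
    (M : Matrix (Fin a) (Fin b) ℝ) :
    μ[fun ω => M *ᵥ X ω | F] =ᵐ[μ] fun ω => M *ᵥ (μ[X | F]) ω :=
  ((LinearMap.toContinuousLinearMap M.mulVecLin).comp_condExp_comm hX).symm

theorem secondMoment_congr {X X' : Ω → Fin a → ℝ} {Y Y' : Ω → Fin b → ℝ}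
    (hX : X =ᵐ[μ] X') (hY : Y =ᵐ[μ] Y') (M : Matrix (Fin a) (Fin b) ℝ) :
    secondMoment μ M X Y = secondMoment μ M X' Y' := by
  refine integral_congr_ae ?_
  filter_upwards [hX, hY] with ω h1 h2
  rw [h1, h2]

theorem secondMoment_matrix_add {X : Ω → Fin a → ℝ} {Y : Ω → Fin b → ℝ} (hX : MemLp X 2 μ)
    (hY : MemLp Y 2 μ) (M N : Matrix (Fin a) (Fin b) ℝ) :
    secondMoment μ (M + N) X Y = secondMoment μ M X Y + secondMoment μ N X Y := by
  unfold secondMoment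
  rw [← integral_add (hX.integrable_bilin hY M) (hX.integrable_bilin hY N)]
  simp only [add_mulVec, dotProduct_add]

theorem secondMoment_mulVec {X : Ω → Fin b → ℝ} {Y : Ω → Fin e → ℝ}
    (C : Matrix (Fin a) (Fin b) ℝ) (M : Matrix (Fin a) (Fin c) ℝ)
    (D : Matrix (Fin c) (Fin e) ℝ) :
    secondMoment μ M (fun ω => C *ᵥ X ω) (fun ω => D *ᵥ Y ω)
      = secondMoment μ (Cᵀ * M * D) X Y := by
  simp only [secondMoment, mulVec_dotProduct_mulVec]

theorem secondMoment_self_nonneg {M : Matrix (Fin a) (Fin a) ℝ} (hM : M.PosSemidef)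
    (X : Ω → Fin a → ℝ) : 0 ≤ secondMoment μ M X X :=
  integral_nonneg fun _ => hM.quad_nonneg _

theorem secondMoment_mono {X : Ω → Fin a → ℝ} {M N : Matrix (Fin a) (Fin a) ℝ} {C : ℝ}
    (hX : MemLp X 2 μ) (h : ∀ x, x ⬝ᵥ M *ᵥ x ≤ C * (x ⬝ᵥ N *ᵥ x)) :
    secondMoment μ M X X ≤ C * secondMoment μ N X X := by
  unfold secondMoment
  rw [← integral_const_mul]
  exact integral_mono (hX.integrable_bilin hX M) ((hX.integrable_bilin hX N).const_mul C)
    fun ω => h (X ω)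

theorem ae_eq_zero_of_secondMoment_eq_zero {M : Matrix (Fin a) (Fin a) ℝ} (hM : M.PosDef)
    {X : Ω → Fin a → ℝ} (hX : MemLp X 2 μ) (h : secondMoment μ M X X = 0) : X =ᵐ[μ] 0 := by
  have := (integral_eq_zero_iff_of_nonneg (fun _ => hM.posSemidef.quad_nonneg _)
    (hX.integrable_bilin hX M)).1 h
  exact this.mono fun ω hω => hM.eq_zero_of_quad_eq_zero hω

theorem secondMoment_const [IsProbabilityMeasure μ] (M : Matrix (Fin a) (Fin b) ℝ)
    (x : Fin a → ℝ) (y : Fin b → ℝ) :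
    secondMoment μ M (fun _ => x) (fun _ => y) = x ⬝ᵥ M *ᵥ y := by
  simp [secondMoment]

theorem secondMoment_self_mulVec_add {M : Matrix (Fin a) (Fin a) ℝ} (hM : Mᵀ = M)
    {X : Ω → Fin b → ℝ} {U : Ω → Fin c → ℝ} (hX : MemLp X 2 μ) (hU : MemLp U 2 μ)
    (A : Matrix (Fin a) (Fin b) ℝ) (B : Matrix (Fin a) (Fin c) ℝ) :
    secondMoment μ M (fun ω => A *ᵥ X ω + B *ᵥ U ω) (fun ω => A *ᵥ X ω + B *ᵥ U ω)
      = secondMoment μ (Aᵀ * M * A) X X + 2 * secondMoment μ (Aᵀ * M * B) X U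
        + secondMoment μ (Bᵀ * M * B) U U := by
  unfold secondMoment
  simp only [dotProduct_mulVec_self_mulVec_add hM]
  rw [integral_add (f := fun ω => X ω ⬝ᵥ (Aᵀ * M * A) *ᵥ X ω
      + 2 * (X ω ⬝ᵥ (Aᵀ * M * B) *ᵥ U ω))
      (((hX.integrable_bilin hX _)).add ((hX.integrable_bilin hU _).const_mul 2))
      (hU.integrable_bilin hU _),
    integral_add (hX.integrable_bilin hX _) ((hX.integrable_bilin hU _).const_mul 2),
    integral_const_mul]

/-- Conditioning on a `σ`-algebra that resolves the left factor. -/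
theorem secondMoment_condExp_right [IsProbabilityMeasure μ]
    (hF : F ≤ mΩ) {X : Ω → Fin a → ℝ} {Y : Ω → Fin b → ℝ}
    (hXF : StronglyMeasurable[F] X) (hX : MemLp X 2 μ) (hY : MemLp Y 2 μ)
    (M : Matrix (Fin a) (Fin b) ℝ) :
    secondMoment μ M X (μ[Y | F]) = secondMoment μ M X Y := by
  unfold secondMoment
  rw [← integral_condExp hF (f := fun ω => X ω ⬝ᵥ M *ᵥ Y ω)]
  have hB : ∀ x y, (LinearMap.toContinuousBilinearMap (Matrix.toLinearMap₂' ℝ M)) x y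
      = x ⬝ᵥ M *ᵥ y := fun x y => by
    simp [Matrix.toLinearMap₂'_apply']
  have := condExp_bilin_of_stronglyMeasurable_left (μ := μ)
    (LinearMap.toContinuousBilinearMap (Matrix.toLinearMap₂' ℝ M)) (f := X) (g := Y) hXF
    (by simpa only [hB] using hX.integrable_bilin hY M) (hY.integrable one_le_two)
  simp only [hB] at this
  exact integral_congr_ae this.symm

theorem secondMoment_swap (M : Matrix (Fin a) (Fin b) ℝ) (X : Ω → Fin a → ℝ)
    (Y : Ω → Fin b → ℝ) : secondMoment μ M X Y = secondMoment μ Mᵀ Y X := by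
  simp only [secondMoment, mulVec_transpose, dotProduct_comm (Y _), dotProduct_mulVec]

theorem secondMoment_condExp_left [IsProbabilityMeasure μ]
    (hF : F ≤ mΩ) {X : Ω → Fin a → ℝ} {Y : Ω → Fin b → ℝ}
    (hYF : StronglyMeasurable[F] Y) (hX : MemLp X 2 μ) (hY : MemLp Y 2 μ)
    (M : Matrix (Fin a) (Fin b) ℝ) :
    secondMoment μ M (μ[X | F]) Y = secondMoment μ M X Y := by
  rw [secondMoment_swap, secondMoment_condExp_right hF hYF hY hX, ← secondMoment_swap]

/-- Conditioning does not increase a positive semidefinite second moment. -/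
theorem secondMoment_condExp_self_le [IsProbabilityMeasure μ]
    (hF : F ≤ mΩ) {M : Matrix (Fin a) (Fin a) ℝ} (hM : M.PosSemidef)
    {X : Ω → Fin a → ℝ} (hX : MemLp X 2 μ) :
    secondMoment μ M (μ[X | F]) (μ[X | F]) ≤ secondMoment μ M X X := by
  have hXF : MemLp (μ[X | F]) 2 μ := hX.condExp one_le_two
  -- This expands the nonnegative moment of X - E[X|F]; by `h2` its cross term is the moment of
  -- E[X|F].
  have h0 := secondMoment_self_mulVec_add hM.transpose_eq hX hXF 1 (-1)
  have h1 := secondMoment_self_nonneg (μ := μ) hM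
    (fun ω => (1 : Matrix (Fin a) (Fin a) ℝ) *ᵥ X ω + (-1 : Matrix (Fin a) (Fin a) ℝ) *ᵥ
      (μ[X | F]) ω)
  have h2 := secondMoment_condExp_left hF stronglyMeasurable_condExp hX hXF M
  have hneg : secondMoment μ (-M) X (μ[X | F]) = - secondMoment μ M X (μ[X | F]) := by
    simp [secondMoment, neg_mulVec, integral_neg]
  simp only [transpose_one, Matrix.one_mul, Matrix.mul_one, Matrix.mul_neg, transpose_neg,
    Matrix.neg_mul, neg_neg, hneg] at h0
  linarith

/-- Given the past, `w k` has mean zero, which removes the cross term, and second moment one, which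
removes the noise from the square. -/
theorem IsWhiteNoise.secondMoment_self_add_smul [IsProbabilityMeasure μ] {w : ℕ → Ω → ℝ}
    (hw : IsWhiteNoise μ w) (k : ℕ) {M : Matrix (Fin a) (Fin a) ℝ} (hM : Mᵀ = M)
    {Y Z : Ω → Fin a → ℝ} (hY : Measurable[noiseAlg w ((k : ℤ) - 1)] Y) (hY2 : MemLp Y 2 μ)
    (hZ : Measurable[noiseAlg w ((k : ℤ) - 1)] Z) (hZ2 : MemLp Z 2 μ) :
    secondMoment μ M (fun ω => Y ω + w k ω • Z ω) (fun ω => Y ω + w k ω • Z ω)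
      = secondMoment μ M Y Y + secondMoment μ M Z Z := by
  have hwZ := hw.memLp_smul k hZ hZ2
  have h0 := secondMoment_self_mulVec_add hM hY2 hwZ 1 1
  have hcross : secondMoment μ M Y (fun ω => w k ω • Z ω) = 0 := by
    rw [← secondMoment_condExp_right (hw.noiseAlg_le ((k : ℤ) - 1)) hY.stronglyMeasurable hY2 hwZ,
      secondMoment_congr (ae_eq_refl Y) (hw.condExp_smul k hZ hZ2 (by omega))]
    simp [secondMoment]
  have hsq : secondMoment μ M (fun ω => w k ω • Z ω) (fun ω => w k ω • Z ω)
      = secondMoment μ M Z Z := by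
    have heq : ∀ ω, (w k ω • Z ω) ⬝ᵥ M *ᵥ (w k ω • Z ω) = w k ω ^ 2 * (Z ω ⬝ᵥ M *ᵥ Z ω) := by
      intro ω
      rw [mulVec_smul, smul_dotProduct, dotProduct_smul, smul_eq_mul, smul_eq_mul]
      ring
    have hint := hwZ.integrable_bilin hwZ M
    simp only [heq] at hint
    simp only [secondMoment, heq]
    refine hw.integral_sq_mul k ?_ hint
    have : Continuous fun z : Fin a → ℝ => z ⬝ᵥ M *ᵥ z := by fun_prop
    exact this.measurable.comp hZ
  simp only [one_mulVec, transpose_one, Matrix.one_mul, Matrix.mul_one, hcross, hsq] at h0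
  linarith

end SecondMoment

/-! ### Trajectories, delayed estimates and the one-step energy balance. -/

namespace LQRData

variable {n m d : ℕ} {Ω : Type*}

/-- The trajectory driven by the inputs `U k`, acting at time `k`. -/
def traj (S : LQRData n m) (w : ℕ → Ω → ℝ) (x0 : Fin n → ℝ) (U : ℕ → Ω → Fin m → ℝ) :
    ℕ → Ω → Fin n → ℝ
  | 0 => fun _ => x0
  | k + 1 => fun ω => (S.A + w k ω • S.Abar) *ᵥ S.traj w x0 U k ω
      + (S.B + w k ω • S.Bbar) *ᵥ U k ω

theorem state_eq_traj (S : LQRData n m) (w : ℕ → Ω → ℝ) (x0 : Fin n → ℝ)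
    (u0 : Fin d → Fin m → ℝ) (u : ℕ → Ω → Fin m → ℝ) (k : ℕ) :
    S.state w x0 u0 u k = S.traj w x0 (delayedInput u0 u) k := by
  induction k with
  | zero => rfl
  | succ k ih => simp only [state, traj, ih]

theorem traj_succ (S : LQRData n m) (w : ℕ → Ω → ℝ) (x0 : Fin n → ℝ)
    (U : ℕ → Ω → Fin m → ℝ) (k : ℕ) :
    S.traj w x0 U (k + 1) = fun ω => (S.A *ᵥ S.traj w x0 U k ω + S.B *ᵥ U k ω)
      + w k ω • (S.Abar *ᵥ S.traj w x0 U k ω + S.Bbar *ᵥ U k ω) := by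
  funext ω
  simp only [traj, add_mulVec, smul_mulVec, smul_add]
  abel

theorem freeState_eq_traj (S : LQRData n m) (w : ℕ → Ω → ℝ) (c : Fin n → ℝ) (k : ℕ) :
    S.freeState w c k = S.traj w c 0 k := by
  induction k with
  | zero => rfl
  | succ k ih => simp [freeState, traj, ih]

theorem traj_congr (S : LQRData n m) (w : ℕ → Ω → ℝ) (x0 : Fin n → ℝ)
    {U U' : ℕ → Ω → Fin m → ℝ} {N : ℕ} (h : ∀ k < N, U k = U' k) {k : ℕ} (hk : k ≤ N) :
    S.traj w x0 U k = S.traj w x0 U' k := by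
  induction k with
  | zero => rfl
  | succ k ih => rw [traj_succ, traj_succ, ih (by omega), h k (by omega)]

theorem delayedInput_congr {u0 : Fin d → Fin m → ℝ} {u v : ℕ → Ω → Fin m → ℝ} {k : ℕ}
    (h : ∀ j, j + d < k → v j = u j) :
    ∀ j < k, delayedInput u0 v j = delayedInput u0 u j := by
  intro j hj
  by_cases hjd : j < d
  · simp only [delayedInput, hjd, dif_pos]
  · simp only [delayedInput, hjd, dif_neg, not_false_eq_true]
    exact h _ (by omega)

variable [MeasurableSpace Ω] {μ : Measure Ω} {w : ℕ → Ω → ℝ}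

/-- Square-integrable inputs that are delayed by `d`: the input at time `k` is
`F_{k-d-1}`-measurable. -/
def IsDelayedControl (μ : Measure Ω) (w : ℕ → Ω → ℝ) (d : ℕ) (U : ℕ → Ω → Fin m → ℝ) : Prop :=
  ∀ k : ℕ, Measurable[noiseAlg w ((k : ℤ) - d - 1)] (U k) ∧ MemLp (U k) 2 μ

theorem IsControl.isDelayedControl [IsFiniteMeasure μ] {u : ℕ → Ω → Fin m → ℝ}
    (hu : IsControl μ w u) (u0 : Fin d → Fin m → ℝ) :
    IsDelayedControl μ w d (delayedInput u0 u) := by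
  intro k
  by_cases hk : k < d
  · simp only [delayedInput, hk, dif_pos]
    exact ⟨measurable_const, memLp_const _⟩
  · simp only [delayedInput, hk, dif_neg, not_false_eq_true]
    have := hu (k - d)
    rwa [show ((k - d : ℕ) : ℤ) - 1 = (k : ℤ) - d - 1 by omega] at this

/-- Every delayed control comes from initial inputs and a control. -/
theorem IsDelayedControl.exists_eq_delayedInput {U : ℕ → Ω → Fin m → ℝ}
    (hU : IsDelayedControl μ w d U) {u0 : Fin d → Fin m → ℝ}
    (hu0 : ∀ k : Fin d, U k = fun _ => u0 k) :
    IsControl μ w (fun j => U (j + d)) ∧ delayedInput u0 (fun j => U (j + d)) = U := by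
  constructor
  · intro k
    have := hU (k + d)
    rwa [show ((k + d : ℕ) : ℤ) - d - 1 = (k : ℤ) - 1 by push_cast; ring] at this
  · funext k
    by_cases hk : k < d
    · simp only [delayedInput, hk, dif_pos]
      exact (hu0 ⟨k, hk⟩).symm
    · simp only [delayedInput, hk, dif_neg, not_false_eq_true]
      rw [Nat.sub_add_cancel (not_lt.1 hk)]

variable {S : LQRData n m} {x0 : Fin n → ℝ} {U : ℕ → Ω → Fin m → ℝ}

theorem IsDelayedControl.undelayed (hU : IsDelayedControl μ w d U) (k : ℕ) :
    Measurable[noiseAlg w ((k : ℤ) - 1)] (U k) ∧ MemLp (U k) 2 μ :=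
  ⟨(hU k).1.mono (noiseAlg_mono (by omega)) le_rfl, (hU k).2⟩

theorem isDelayedControl_zero : IsDelayedControl μ w d (0 : ℕ → Ω → Fin m → ℝ) :=
  fun _ => ⟨measurable_const, MemLp.zero⟩

variable (S μ w x0 U) in
/-- The estimate `x_k|_{k-i-1}` of the state at time `k` with delay `i`. -/
noncomputable def estimate (k i : ℕ) : Ω → Fin n → ℝ :=
  μ[S.traj w x0 U k | noiseAlg w ((k : ℤ) - i - 1)]

variable (S μ w x0 U) in
/-- The expected stage cost as a real number. -/
noncomputable def stage (k : ℕ) : ℝ :=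
  secondMoment μ S.Q (S.traj w x0 U k) (S.traj w x0 U k) + secondMoment μ S.R (U k) (U k)

variable (S μ w x0 U) in
/-- The quadratic Lyapunov functional attached to weights `P^0, …, P^d`. -/
noncomputable def energy (P : Fin (d + 1) → Matrix (Fin n) (Fin n) ℝ) (k : ℕ) : ℝ :=
  secondMoment μ (P (Fin.last d)) (S.estimate μ w x0 U k d) (S.estimate μ w x0 U k d)
    + ∑ i : Fin d, (secondMoment μ (P i.castSucc) (S.estimate μ w x0 U k i)
        (S.estimate μ w x0 U k i)
      - secondMoment μ (P i.castSucc) (S.estimate μ w x0 U k (i + 1))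
        (S.estimate μ w x0 U k (i + 1)))

variable (S μ w x0 U) in
/-- The expected weighted deviation of the input from the feedback law. -/
noncomputable def deviation (P : Fin (d + 1) → Matrix (Fin n) (Fin n) ℝ) (k : ℕ) : ℝ :=
  secondMoment μ (S.inputWeight P) (fun ω => U k ω + S.gain P *ᵥ S.estimate μ w x0 U k d ω)
    (fun ω => U k ω + S.gain P *ᵥ S.estimate μ w x0 U k d ω)

theorem energy_zero_weight (k : ℕ) :
    S.energy μ w x0 U (0 : Fin (d + 1) → Matrix (Fin n) (Fin n) ℝ) k = 0 := by
  simp [energy, secondMoment]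

variable [IsProbabilityMeasure μ]

theorem traj_measurable_memLp (hw : IsWhiteNoise μ w)
    (hU : ∀ k : ℕ, Measurable[noiseAlg w ((k : ℤ) - 1)] (U k) ∧ MemLp (U k) 2 μ) (k : ℕ) :
    Measurable[noiseAlg w ((k : ℤ) - 1)] (S.traj w x0 U k) ∧ MemLp (S.traj w x0 U k) 2 μ := by
  induction k with
  | zero => exact ⟨measurable_const, memLp_const _⟩
  | succ k ih =>
    have hmul : ∀ {a b : ℕ} (M : Matrix (Fin a) (Fin b) ℝ), Measurable fun x => M *ᵥ x :=
      fun M => (by fun_prop : Continuous fun x => M *ᵥ x).measurable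
    have hZ : Measurable[noiseAlg w ((k : ℤ) - 1)]
        fun ω => S.Abar *ᵥ S.traj w x0 U k ω + S.Bbar *ᵥ U k ω :=
      ((hmul _).comp ih.1).add ((hmul _).comp (hU k).1)
    have hY : Measurable[noiseAlg w ((k : ℤ) - 1)]
        fun ω => S.A *ᵥ S.traj w x0 U k ω + S.B *ᵥ U k ω :=
      ((hmul _).comp ih.1).add ((hmul _).comp (hU k).1)
    have hle : noiseAlg w ((k : ℤ) - 1) ≤ noiseAlg w (((k + 1 : ℕ) : ℤ) - 1) :=
      noiseAlg_mono (by push_cast; omega)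
    rw [traj_succ]
    refine ⟨?_, ?_⟩
    · exact (hY.mono hle le_rfl).add
        ((measurable_noiseAlg (by push_cast; omega)).smul (hZ.mono hle le_rfl))
    · exact ((ih.2.mulVec _).add ((hU k).2.mulVec _)).add
        (hw.memLp_smul k hZ ((ih.2.mulVec _).add ((hU k).2.mulVec _)))

/-- The second moment of the next state. -/
theorem secondMoment_traj_succ (hw : IsWhiteNoise μ w)
    (hU : ∀ k : ℕ, Measurable[noiseAlg w ((k : ℤ) - 1)] (U k) ∧ MemLp (U k) 2 μ) (k : ℕ)
    {M : Matrix (Fin n) (Fin n) ℝ} (hM : Mᵀ = M) :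
    secondMoment μ M (S.traj w x0 U (k + 1)) (S.traj w x0 U (k + 1))
      = secondMoment μ M (fun ω => S.A *ᵥ S.traj w x0 U k ω + S.B *ᵥ U k ω)
          (fun ω => S.A *ᵥ S.traj w x0 U k ω + S.B *ᵥ U k ω)
        + secondMoment μ M (fun ω => S.Abar *ᵥ S.traj w x0 U k ω + S.Bbar *ᵥ U k ω)
          (fun ω => S.Abar *ᵥ S.traj w x0 U k ω + S.Bbar *ᵥ U k ω) := by
  have hmul : ∀ {a b : ℕ} (M : Matrix (Fin a) (Fin b) ℝ), Measurable fun x => M *ᵥ x :=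
    fun M => (by fun_prop : Continuous fun x => M *ᵥ x).measurable
  obtain ⟨hX, hX2⟩ := traj_measurable_memLp (S := S) (x0 := x0) hw hU k
  rw [traj_succ]
  exact hw.secondMoment_self_add_smul k hM
    (((hmul _).comp hX).add ((hmul _).comp (hU k).1)) ((hX2.mulVec _).add ((hU k).2.mulVec _))
    (((hmul _).comp hX).add ((hmul _).comp (hU k).1)) ((hX2.mulVec _).add ((hU k).2.mulVec _))

theorem estimate_zero (hw : IsWhiteNoise μ w)
    (hU : ∀ k : ℕ, Measurable[noiseAlg w ((k : ℤ) - 1)] (U k) ∧ MemLp (U k) 2 μ) (k : ℕ) :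
    S.estimate μ w x0 U k 0 = S.traj w x0 U k := by
  obtain ⟨hX, hX2⟩ := traj_measurable_memLp (S := S) (x0 := x0) hw hU k
  rw [estimate, show (k : ℤ) - (0 : ℕ) - 1 = k - 1 by simp]
  exact condExp_of_stronglyMeasurable (hw.noiseAlg_le _) hX.stronglyMeasurable
    (hX2.integrable one_le_two)

theorem memLp_estimate (hw : IsWhiteNoise μ w)
    (hU : ∀ k : ℕ, Measurable[noiseAlg w ((k : ℤ) - 1)] (U k) ∧ MemLp (U k) 2 μ) (k i : ℕ) :
    MemLp (S.estimate μ w x0 U k i) 2 μ :=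
  (traj_measurable_memLp hw hU k).2.condExp one_le_two

/-- Raising the time and the delay together keeps the σ-algebra F_{k-i-1}. The noise w_k averages
out over it, and `i ≤ d` makes `U k` measurable for it. -/
theorem estimate_succ (hw : IsWhiteNoise μ w) (hU : IsDelayedControl μ w d U) (k : ℕ) {i : ℕ}
    (hi : i ≤ d) :
    S.estimate μ w x0 U (k + 1) (i + 1) =ᵐ[μ]
      fun ω => S.A *ᵥ S.estimate μ w x0 U k i ω + S.B *ᵥ U k ω := by
  obtain ⟨hX, hX2⟩ := traj_measurable_memLp (S := S) (x0 := x0) hw hU.undelayed k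
  have hmul : ∀ {a b : ℕ} (M : Matrix (Fin a) (Fin b) ℝ), Measurable fun x => M *ᵥ x :=
    fun M => (by fun_prop : Continuous fun x => M *ᵥ x).measurable
  have hU' := (hU.undelayed k).1
  have hU2 := (hU k).2
  have hZ : Measurable[noiseAlg w ((k : ℤ) - 1)]
      fun ω => S.Abar *ᵥ S.traj w x0 U k ω + S.Bbar *ᵥ U k ω :=
    ((hmul _).comp hX).add ((hmul _).comp hU')
  have hZ2 : MemLp (fun ω => S.Abar *ᵥ S.traj w x0 U k ω + S.Bbar *ᵥ U k ω) 2 μ :=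
    (hX2.mulVec _).add (hU2.mulVec _)
  have hBU : Measurable[noiseAlg w ((k : ℤ) - i - 1)] fun ω => S.B *ᵥ U k ω :=
    (hmul _).comp ((hU k).1.mono (noiseAlg_mono (by omega)) le_rfl)
  have h1 := hw.condExp_smul k hZ hZ2 (t := (k : ℤ) - i - 1) (by omega)
  have h2 := condExp_mulVec (F := noiseAlg w ((k : ℤ) - i - 1)) (hX2.integrable one_le_two) S.A
  have h3 := condExp_of_stronglyMeasurable (μ := μ) (hw.noiseAlg_le ((k : ℤ) - i - 1))
    hBU.stronglyMeasurable ((hU2.mulVec S.B).integrable one_le_two)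
  have h4 := condExp_add (μ := μ) ((hX2.mulVec S.A).integrable one_le_two)
    ((hU2.mulVec S.B).integrable one_le_two) (noiseAlg w ((k : ℤ) - i - 1))
  have h5 := condExp_add (μ := μ)
    (((hX2.mulVec S.A).add (hU2.mulVec S.B)).integrable one_le_two)
    ((hw.memLp_smul k hZ hZ2).integrable one_le_two) (noiseAlg w ((k : ℤ) - i - 1))
  rw [estimate, traj_succ,
    show ((k + 1 : ℕ) : ℤ) - ((i + 1 : ℕ) : ℤ) - 1 = (k : ℤ) - i - 1 by push_cast; ring]
  refine h5.trans ?_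
  filter_upwards [h1, h2, h4] with ω e1 e2 e4
  rw [Pi.add_apply, e1, e4, Pi.add_apply, e2, h3]
  simp [estimate]

/-- The one-step energy balance. -/
theorem energy_succ_add_stage (hw : IsWhiteNoise μ w) (hR : S.R.PosDef)
    (hU : IsDelayedControl μ w d U) {P : Fin (d + 1) → Matrix (Fin n) (Fin n) ℝ}
    (hP : ∀ i, (P i).PosSemidef) (k : ℕ) :
    S.energy μ w x0 U P (k + 1) + S.stage μ w x0 U k
      = S.energy μ w x0 U (S.riccatiMap P) k + S.deviation μ w x0 U P k := by
  obtain ⟨hX, hX2⟩ := traj_measurable_memLp (S := S) (x0 := x0) hw hU.undelayed k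
  have hU2 := (hU k).2
  have hE2 := fun i => memLp_estimate (S := S) (x0 := x0) hw hU.undelayed k i
  set X := S.traj w x0 U k with hXdef
  set E := S.estimate μ w x0 U k with hEdef
  have hE0 : E 0 = X := estimate_zero hw hU.undelayed k
  let α : ℕ → Matrix (Fin n) (Fin n) ℝ → ℝ := fun i M => secondMoment μ M (E i) (E i)
  let G : Matrix (Fin n) (Fin n) ℝ → ℕ → ℝ := fun M i =>
    secondMoment μ M (fun ω => S.A *ᵥ E i ω + S.B *ᵥ U k ω)
      (fun ω => S.A *ᵥ E i ω + S.B *ᵥ U k ω)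
  let Gbar : Matrix (Fin n) (Fin n) ℝ → ℕ → ℝ := fun M i =>
    secondMoment μ M (fun ω => S.Abar *ᵥ E i ω + S.Bbar *ᵥ U k ω)
      (fun ω => S.Abar *ᵥ E i ω + S.Bbar *ᵥ U k ω)
  -- The input is known at every delay up to `d`, so cross terms do not depend on `i` and cancel in
  -- differences over consecutive delays.
  have hcross : ∀ i ≤ d, ∀ N : Matrix (Fin n) (Fin m) ℝ,
      secondMoment μ N (E i) (U k) = secondMoment μ N X (U k) := fun i hi N =>
    secondMoment_condExp_left (hw.noiseAlg_le _)
      ((hU k).1.mono (noiseAlg_mono (by omega)) le_rfl).stronglyMeasurable hX2 hU2 N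
  have hG : ∀ M : Matrix (Fin n) (Fin n) ℝ, Mᵀ = M → ∀ i ≤ d, G M i
      = α i (S.Aᵀ * M * S.A) + 2 * secondMoment μ (S.Aᵀ * M * S.B) X (U k)
        + secondMoment μ (S.Bᵀ * M * S.B) (U k) (U k) := fun M hM i hi => by
    rw [← hcross i hi]
    exact secondMoment_self_mulVec_add hM (hE2 i) hU2 _ _
  have hGbar : ∀ M : Matrix (Fin n) (Fin n) ℝ, Mᵀ = M → ∀ i ≤ d, Gbar M i
      = α i (S.Abarᵀ * M * S.Abar) + 2 * secondMoment μ (S.Abarᵀ * M * S.Bbar) X (U k)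
        + secondMoment μ (S.Bbarᵀ * M * S.Bbar) (U k) (U k) := fun M hM i hi => by
    rw [← hcross i hi]
    exact secondMoment_self_mulVec_add hM (hE2 i) hU2 _ _
  -- the terms of the energy at time `k + 1`
  let T : Fin (d + 1) → ℝ := fun i => secondMoment μ (P i) (S.estimate μ w x0 U (k + 1) i)
    (S.estimate μ w x0 U (k + 1) i)
  have hsucc : ∀ (M : Matrix (Fin n) (Fin n) ℝ), ∀ i ≤ d,
      secondMoment μ M (S.estimate μ w x0 U (k + 1) (i + 1))
        (S.estimate μ w x0 U (k + 1) (i + 1)) = G M i := fun M i hi =>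
    secondMoment_congr (estimate_succ hw hU k hi) (estimate_succ hw hU k hi) M
  -- Delay zero is the only place where w_k contributes; hence `P 0` alone multiplies the noise
  -- matrices.
  have hT0 : T 0 = G (P 0) 0 + Gbar (P 0) 0 := by
    change secondMoment μ (P 0) (S.estimate μ w x0 U (k + 1) 0)
      (S.estimate μ w x0 U (k + 1) 0) = _
    rw [estimate_zero hw hU.undelayed, secondMoment_traj_succ hw hU.undelayed k
      (hP 0).transpose_eq]
    simp only [G, Gbar, hE0, hXdef]
  have hTsum : T (Fin.last d) + ∑ i : Fin d, T i.castSucc = T 0 + ∑ i : Fin d, T i.succ := by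
    rw [add_comm, ← Fin.sum_univ_castSucc, Fin.sum_univ_succ]
  have hTsucc : ∀ i : Fin d, T i.succ = G (P i.succ) i := fun i => by
    have := hsucc (P i.succ) i i.2.le
    simpa [T] using this
  have hV' : S.energy μ w x0 U P (k + 1)
      = G (P 0) 0 + Gbar (P 0) 0 + ∑ i : Fin d, G (P i.succ) i
        - ∑ i : Fin d, G (P i.castSucc) i := by
    have h1 : S.energy μ w x0 U P (k + 1)
        = T (Fin.last d) + ∑ i : Fin d, T i.castSucc - ∑ i : Fin d, G (P i.castSucc) i := by
      simp only [energy, Finset.sum_sub_distrib, T, Fin.val_last, Fin.val_castSucc]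
      rw [Finset.sum_congr rfl fun (i : Fin d) _ => hsucc (P i.castSucc) i i.2.le]
      ring
    rw [h1, hTsum, hT0]
    simp only [hTsucc]
  -- the terms of the energy at time `k`
  have hHsum : G (P (Fin.last d)) d + ∑ i : Fin d, G (P i.castSucc) i
      = G (P 0) 0 + ∑ i : Fin d, G (P i.succ) (i + 1) := by
    have h1 := Fin.sum_univ_castSucc fun j : Fin (d + 1) => G (P j) j
    have h2 := Fin.sum_univ_succ fun j : Fin (d + 1) => G (P j) j
    simp only [Fin.val_last, Fin.val_castSucc, Fin.val_succ, Fin.val_zero] at h1 h2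
    linarith
  have htel : ∀ f : ℕ → ℝ, ∑ i : Fin d, (f i - f (i + 1)) = f 0 - f d := fun f => by
    rw [Fin.sum_univ_eq_sum_range (fun i => f i - f (i + 1)), Finset.sum_range_sub']
  have hα : ∀ i (M N : Matrix (Fin n) (Fin n) ℝ), α i (S.uncontrolledStep M N)
      = α i (S.Aᵀ * M * S.A) + α i (S.Abarᵀ * N * S.Abar) + α i S.Q := fun i M N => by
    simp only [α, uncontrolledStep]
    rw [secondMoment_matrix_add (hE2 i) (hE2 i), secondMoment_matrix_add (hE2 i) (hE2 i)]
  have hdiff : ∀ i : Fin d, α i (S.riccatiMap P i.castSucc) - α (i + 1) (S.riccatiMap P i.castSucc)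
      = (G (P i.succ) i - G (P i.succ) (i + 1)) + (Gbar (P 0) i - Gbar (P 0) (i + 1))
        + (α i S.Q - α (i + 1) S.Q) := fun i => by
    rw [riccatiMap_castSucc, hα, hα, hG _ (hP _).transpose_eq _ i.2.le,
      hG _ (hP _).transpose_eq _ i.2, hGbar _ (hP _).transpose_eq _ i.2.le,
      hGbar _ (hP _).transpose_eq _ i.2]
    ring
  have hV : S.energy μ w x0 U (S.riccatiMap P) k
      = α d (S.riccatiMap P (Fin.last d))
        + (∑ i : Fin d, G (P i.succ) i - ∑ i : Fin d, G (P i.succ) (i + 1))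
        + (Gbar (P 0) 0 - Gbar (P 0) d) + (α 0 S.Q - α d S.Q) := by
    have h1 : S.energy μ w x0 U (S.riccatiMap P) k = α d (S.riccatiMap P (Fin.last d))
        + ∑ i : Fin d, (α i (S.riccatiMap P i.castSucc)
          - α (i + 1) (S.riccatiMap P i.castSucc)) := rfl
    rw [h1, Finset.sum_congr rfl fun i _ => hdiff i, Finset.sum_add_distrib,
      Finset.sum_add_distrib, htel (Gbar (P 0)), htel fun i => α i S.Q, Finset.sum_sub_distrib]
    ring
  -- After the cancellations the input survives only together with the estimate of delay `d`, on
  -- which the controller can act; the square is completed pointwise.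
  have hsquare : G (P (Fin.last d)) d + Gbar (P 0) d + secondMoment μ S.R (U k) (U k) + α d S.Q
      = α d (S.riccatiMap P (Fin.last d)) + S.deviation μ w x0 U P k := by
    have i1 := (((hE2 d).mulVec S.A).add (hU2.mulVec S.B)).integrable_bilin
      (((hE2 d).mulVec S.A).add (hU2.mulVec S.B)) (P (Fin.last d))
    have i2 := (((hE2 d).mulVec S.Abar).add (hU2.mulVec S.Bbar)).integrable_bilin
      (((hE2 d).mulVec S.Abar).add (hU2.mulVec S.Bbar)) (P 0)
    have i3 := hU2.integrable_bilin hU2 S.R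
    have i4 := (hE2 d).integrable_bilin (hE2 d) S.Q
    have i5 := (hE2 d).integrable_bilin (hE2 d) (S.riccatiMap P (Fin.last d))
    have i6 := (hU2.add ((hE2 d).mulVec (S.gain P))).integrable_bilin
      (hU2.add ((hE2 d).mulVec (S.gain P))) (S.inputWeight P)
    have j1 := integral_add i1 i2
    have j2 := integral_add (i1.add i2) i3
    have j3 := integral_add ((i1.add i2).add i3) i4
    have j4 := integral_add i5 i6
    simp only [Pi.add_apply] at j1 j2 j3 j4
    simp only [G, Gbar, α, deviation, secondMoment, ← hEdef]
    rw [← j1, ← j2, ← j3, ← j4]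
    exact integral_congr_ae (ae_of_all _ fun ω => stage_add_quad_eq hR hP (E d ω) (U k ω))
  have hstage : S.stage μ w x0 U k = α 0 S.Q + secondMoment μ S.R (U k) (U k) := by
    simp only [stage, α, hE0, hXdef]
  rw [hV', hV, hstage]
  linarith

end LQRData

/-! ### Observability and the energy balance over long horizons. -/

theorem sum_range_succ_shift (f : ℕ → ℝ) (k L : ℕ) :
    ∑ j ∈ Finset.range (L + 1), f (k + j) = ∑ j ∈ Finset.range L, f (k + 1 + j) + f k := by
  rw [Finset.sum_range_succ', add_zero]
  exact congrArg (· + f k) (Finset.sum_congr rfl fun j _ => by rw [add_right_comm, add_assoc])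

theorem secondMoment_matrix_smul {Ω : Type*} [MeasurableSpace Ω] {μ : Measure Ω} {a b : ℕ}
    (r : ℝ) (M : Matrix (Fin a) (Fin b) ℝ) (X : Ω → Fin a → ℝ) (Y : Ω → Fin b → ℝ) :
    secondMoment μ (r • M) X Y = r * secondMoment μ M X Y := by
  simp only [secondMoment, smul_mulVec, dotProduct_smul, smul_eq_mul, integral_const_mul]

theorem secondMoment_conj_le {Ω : Type*} [MeasurableSpace Ω] {μ : Measure Ω} {a b c : ℕ}
    {M : Matrix (Fin a) (Fin a) ℝ} (hM : M.PosSemidef)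
    {X : Ω → Fin b → ℝ} {U : Ω → Fin c → ℝ} (hX : MemLp X 2 μ) (hU : MemLp U 2 μ)
    (A : Matrix (Fin a) (Fin b) ℝ) (B : Matrix (Fin a) (Fin c) ℝ) :
    secondMoment μ (Aᵀ * M * A) X X
      ≤ 2 * secondMoment μ M (fun ω => A *ᵥ X ω + B *ᵥ U ω) (fun ω => A *ᵥ X ω + B *ᵥ U ω)
        + 2 * secondMoment μ (Bᵀ * M * B) U U := by
  have h1 := secondMoment_self_mulVec_add hM.transpose_eq hX hU A B
  -- The difference of the two sides is the moment of AX + 2BU, as 2(a + b)² + 2b² - a² = (a + 2b)².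
  have h2 := secondMoment_self_mulVec_add hM.transpose_eq hX hU A ((2 : ℝ) • B)
  have h3 := secondMoment_self_nonneg (μ := μ) hM fun ω => A *ᵥ X ω + ((2 : ℝ) • B) *ᵥ U ω
  simp only [transpose_smul, Matrix.smul_mul, Matrix.mul_smul, secondMoment_matrix_smul] at h2
  linarith

namespace LQRData

variable {n m d : ℕ} {Ω : Type*} [MeasurableSpace Ω] {μ : Measure Ω} {w : ℕ → Ω → ℝ}
  {S : LQRData n m} {x0 : Fin n → ℝ} {U : ℕ → Ω → Fin m → ℝ}

theorem stage_nonneg (hQ : S.Q.PosSemidef) (hR : S.R.PosDef) (k : ℕ) :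
    0 ≤ S.stage μ w x0 U k :=
  add_nonneg (secondMoment_self_nonneg hQ _) (secondMoment_self_nonneg hR.posSemidef _)

theorem deviation_nonneg (hR : S.R.PosDef) {P : Fin (d + 1) → Matrix (Fin n) (Fin n) ℝ}
    (hP : ∀ i, (P i).PosSemidef) (k : ℕ) : 0 ≤ S.deviation μ w x0 U P k :=
  secondMoment_self_nonneg (inputWeight_posDef hR hP).posSemidef _

/-- The observability Gramian of the uncontrolled system over a finite horizon. -/
def gramian (S : LQRData n m) : ℕ → Matrix (Fin n) (Fin n) ℝ
  | 0 => 0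
  | L + 1 => S.uncontrolledStep (S.gramian L) (S.gramian L)

theorem gramian_posSemidef (hQ : S.Q.PosSemidef) (L : ℕ) : (S.gramian L).PosSemidef := by
  induction L with
  | zero => exact PosSemidef.zero
  | succ L ih => exact uncontrolledStep_posSemidef hQ ih ih

variable (S μ w x0 U) in
/-- The cost from time `k` on of a sequence of inputs. -/
noncomputable def inputCost (k : ℕ) : ℝ≥0∞ :=
  ∑' j : ℕ, ENNReal.ofReal (S.stage μ w x0 U (k + j))

theorem sum_stage_le_toReal_inputCost (hQ : S.Q.PosSemidef) (hR : S.R.PosDef)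
    (hfin : S.inputCost μ w x0 U 0 ≠ ∞) (T : ℕ) :
    ∑ j ∈ Finset.range T, S.stage μ w x0 U (0 + j) ≤ (S.inputCost μ w x0 U 0).toReal := by
  rw [← ENNReal.ofReal_le_iff_le_toReal hfin,
    ENNReal.ofReal_sum_of_nonneg fun _ _ => stage_nonneg hQ hR _]
  exact ENNReal.sum_le_tsum _

variable [IsProbabilityMeasure μ]

theorem secondMoment_gramian_traj_zero (hw : IsWhiteNoise μ w) (hQ : S.Q.PosSemidef)
    (c : Fin n → ℝ) (L k : ℕ) :
    secondMoment μ (S.gramian L) (S.traj w c 0 k) (S.traj w c 0 k)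
      = ∑ j ∈ Finset.range L,
        secondMoment μ S.Q (S.traj w c 0 (k + j)) (S.traj w c 0 (k + j)) := by
  have hU : ∀ k : ℕ, Measurable[noiseAlg w ((k : ℤ) - 1)] ((0 : ℕ → Ω → Fin m → ℝ) k)
      ∧ MemLp ((0 : ℕ → Ω → Fin m → ℝ) k) 2 μ := fun k => ⟨measurable_const, MemLp.zero⟩
  induction L generalizing k with
  | zero => simp [gramian, secondMoment]
  | succ L ih =>
    obtain ⟨-, hX2⟩ := traj_measurable_memLp (S := S) (x0 := c) hw hU k
    have h1 := secondMoment_traj_succ (S := S) (x0 := c) hw hU k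
      (gramian_posSemidef hQ L).transpose_eq
    simp only [Pi.zero_apply, mulVec_zero, add_zero, secondMoment_mulVec] at h1
    rw [sum_range_succ_shift fun i => secondMoment μ S.Q (S.traj w c 0 i) (S.traj w c 0 i),
      ← ih (k + 1), h1, gramian, uncontrolledStep, secondMoment_matrix_add hX2 hX2,
      secondMoment_matrix_add hX2 hX2]

theorem quad_gramian (hw : IsWhiteNoise μ w) (hQ : S.Q.PosSemidef) (c : Fin n → ℝ) (L : ℕ) :
    c ⬝ᵥ S.gramian L *ᵥ c = ∑ j ∈ Finset.range L,
        secondMoment μ S.Q (S.traj w c 0 j) (S.traj w c 0 j) := by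
  have := secondMoment_gramian_traj_zero hw hQ c L 0
  simp only [zero_add] at this
  rw [← this]
  exact (secondMoment_const _ _ _).symm

/-- Exact observability makes some finite-horizon Gramian positive definite. -/
theorem ExactlyObservable.exists_gramian_posDef (hobs : S.ExactlyObservable μ w)
    (hw : IsWhiteNoise μ w) (hQ : S.Q.PosSemidef) : ∃ L, (S.gramian L).PosDef := by
  have hker : ∀ L c, c ∈ LinearMap.ker (S.gramian L).mulVecLin ↔ c ⬝ᵥ S.gramian L *ᵥ c = 0 := by
    intro L c
    have := (gramian_posSemidef hQ L).dotProduct_mulVec_zero_iff c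
    simp only [star_trivial] at this
    rw [this, LinearMap.mem_ker, mulVecLin_apply]
  have hanti : ∀ {L L' : ℕ} {c : Fin n → ℝ}, L ≤ L' →
      c ⬝ᵥ S.gramian L *ᵥ c ≤ c ⬝ᵥ S.gramian L' *ᵥ c := by
    intro L L' c h
    rw [quad_gramian hw hQ, quad_gramian hw hQ]
    exact Finset.sum_le_sum_of_subset_of_nonneg (Finset.range_mono h)
      fun _ _ _ => secondMoment_self_nonneg hQ _
  -- The kernels of the Gramians form a decreasing chain of subspaces of ℝⁿ, so from some `L` on
  -- they are constant. A vector in that kernel has zero output at all times.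
  obtain ⟨L, hL⟩ := IsArtinian.monotone_stabilizes (R := ℝ) (M := Fin n → ℝ)
    { toFun := fun L => OrderDual.toDual (LinearMap.ker (S.gramian L).mulVecLin)
      monotone' := fun L L' h => by
        refine OrderDual.toDual_le_toDual.2 fun c hc => ?_
        rw [hker] at hc ⊢
        exact le_antisymm ((hanti h).trans hc.le)
          ((gramian_posSemidef hQ L).quad_nonneg c) }
  refine ⟨L, posDef_of_transpose_eq (gramian_posSemidef hQ L).transpose_eq fun c hc => ?_⟩
  refine lt_of_le_of_ne ((gramian_posSemidef hQ L).quad_nonneg c) fun h0 => hc (hobs c ?_)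
  have hzero : ∀ L', c ⬝ᵥ S.gramian L' *ᵥ c = 0 := by
    intro L'
    rcases le_total L' L with h | h
    · exact le_antisymm ((hanti h).trans h0.ge) ((gramian_posSemidef hQ L').quad_nonneg c)
    · have h1 : LinearMap.ker (S.gramian L).mulVecLin = LinearMap.ker (S.gramian L').mulVecLin :=
        hL L' h
      rw [← hker, ← h1, hker]
      exact h0.symm
  intro k
  have hk := hzero (k + 1)
  have hk0 := hzero k
  rw [quad_gramian hw hQ] at hk hk0
  rw [Finset.sum_range_succ, hk0, zero_add] at hk
  have hX2 := (traj_measurable_memLp (S := S) (x0 := c) (U := (0 : ℕ → Ω → Fin m → ℝ)) hw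
    (fun k => ⟨measurable_const, MemLp.zero⟩) k).2
  have hae := (integral_eq_zero_iff_of_nonneg (fun _ => hQ.quad_nonneg _)
    (hX2.integrable_bilin hX2 S.Q)).1 hk
  filter_upwards [hae] with ω hω
  rw [freeState_eq_traj]
  set z := S.traj w c 0 k ω
  have hs : (CFC.sqrt S.Q)ᵀ = CFC.sqrt S.Q :=
    (Matrix.nonneg_iff_posSemidef.1 (CFC.sqrt_nonneg S.Q)).transpose_eq
  have hss : CFC.sqrt S.Q * CFC.sqrt S.Q = S.Q :=
    CFC.sqrt_mul_sqrt_self S.Q (Matrix.nonneg_iff_posSemidef.2 hQ)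
  have h2 : (CFC.sqrt S.Q *ᵥ z) ⬝ᵥ (CFC.sqrt S.Q *ᵥ z) = 0 := by
    have := mulVec_dotProduct_mulVec (CFC.sqrt S.Q) 1 (CFC.sqrt S.Q) z z
    rw [one_mulVec, Matrix.mul_one, hs, hss] at this
    rw [this]
    exact hω
  exact dotProduct_self_eq_zero.1 h2

/-- The Gramian describes the uncontrolled system; replacing each controlled step by an uncontrolled
one costs a quadratic term in the input, which R > 0 dominates. -/
theorem exists_secondMoment_gramian_le (hw : IsWhiteNoise μ w) (hQ : S.Q.PosSemidef)
    (hR : S.R.PosDef) (L : ℕ) : ∃ C, 0 ≤ C ∧ ∀ (x0 : Fin n → ℝ) (U : ℕ → Ω → Fin m → ℝ),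
      (∀ k : ℕ, Measurable[noiseAlg w ((k : ℤ) - 1)] (U k) ∧ MemLp (U k) 2 μ) → ∀ k,
        secondMoment μ (S.gramian L) (S.traj w x0 U k) (S.traj w x0 U k)
          ≤ C * ∑ j ∈ Finset.range L, S.stage μ w x0 U (k + j) := by
  induction L with
  | zero => exact ⟨0, le_rfl, fun x0 U _ k => by simp [gramian, secondMoment]⟩
  | succ L ih =>
    obtain ⟨C, hC, hbound⟩ := ih
    set M := S.gramian L
    have hM : M.PosSemidef := gramian_posSemidef hQ L
    obtain ⟨D, hD, hMR⟩ := hR.exists_quad_le (S.Bᵀ * M * S.B + S.Bbarᵀ * M * S.Bbar)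
    -- `2 * C` pays for the later stages, `2 * D` for removing the present input, and `1` for the
    -- present Q-term.
    refine ⟨2 * C + 2 * D + 1, by positivity, fun x0 U hU k => ?_⟩
    obtain ⟨-, hX2⟩ := traj_measurable_memLp (S := S) (x0 := x0) hw hU k
    have hU2 := (hU k).2
    have h1 := secondMoment_traj_succ (S := S) (x0 := x0) hw hU k hM.transpose_eq
    have h2 := secondMoment_conj_le hM hX2 hU2 S.A S.B
    have h3 := secondMoment_conj_le hM hX2 hU2 S.Abar S.Bbar
    have h4 := secondMoment_mono hU2 hMR
    rw [secondMoment_matrix_add hU2 hU2] at h4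
    have h5 := hbound x0 U hU (k + 1)
    have h6 : secondMoment μ (S.gramian (L + 1)) (S.traj w x0 U k) (S.traj w x0 U k)
        = secondMoment μ (S.Aᵀ * M * S.A) (S.traj w x0 U k) (S.traj w x0 U k)
          + secondMoment μ (S.Abarᵀ * M * S.Abar) (S.traj w x0 U k) (S.traj w x0 U k)
          + secondMoment μ S.Q (S.traj w x0 U k) (S.traj w x0 U k) := by
      rw [gramian, uncontrolledStep, secondMoment_matrix_add hX2 hX2,
        secondMoment_matrix_add hX2 hX2]
    rw [sum_range_succ_shift, h6]
    set s := ∑ j ∈ Finset.range L, S.stage μ w x0 U (k + 1 + j)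
    have hs : 0 ≤ s := Finset.sum_nonneg fun _ _ => stage_nonneg hQ hR _
    have hq := secondMoment_self_nonneg (μ := μ) hQ (S.traj w x0 U k)
    have hr := secondMoment_self_nonneg (μ := μ) hR.posSemidef (U k)
    have hst : S.stage μ w x0 U k = secondMoment μ S.Q (S.traj w x0 U k) (S.traj w x0 U k)
      + secondMoment μ S.R (U k) (U k) := rfl
    rw [hst]
    nlinarith [mul_nonneg hD hs, mul_nonneg hD hq, mul_nonneg hC hq, mul_nonneg hC hr]

/-- Under exact observability the mean square of the state is controlled by the cost over a
finite horizon, uniformly in time and in the inputs. -/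
theorem ExactlyObservable.exists_sq_le (hobs : S.ExactlyObservable μ w) (hw : IsWhiteNoise μ w)
    (hQ : S.Q.PosSemidef) (hR : S.R.PosDef) :
    ∃ L C, 0 ≤ C ∧ ∀ (x0 : Fin n → ℝ) (U : ℕ → Ω → Fin m → ℝ),
      (∀ k : ℕ, Measurable[noiseAlg w ((k : ℤ) - 1)] (U k) ∧ MemLp (U k) 2 μ) → ∀ k,
        secondMoment μ 1 (S.traj w x0 U k) (S.traj w x0 U k)
          ≤ C * ∑ j ∈ Finset.range L, S.stage μ w x0 U (k + j) := by
  obtain ⟨L, hL⟩ := hobs.exists_gramian_posDef hw hQ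
  obtain ⟨C, hC, hbound⟩ := exists_secondMoment_gramian_le hw hQ hR L
  obtain ⟨D, hD, hle⟩ := hL.exists_quad_le 1
  refine ⟨L, D * C, mul_nonneg hD hC, fun x0 U hU k => ?_⟩
  refine (secondMoment_mono (traj_measurable_memLp hw hU k).2 hle).trans ?_
  rw [mul_assoc]
  exact mul_le_mul_of_nonneg_left (hbound x0 U hU k) hD

/-- Finite cost forces mean-square stability. -/
theorem ExactlyObservable.tendsto_of_inputCost_ne_top (hobs : S.ExactlyObservable μ w)
    (hw : IsWhiteNoise μ w) (hQ : S.Q.PosSemidef) (hR : S.R.PosDef)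
    (hU : ∀ k : ℕ, Measurable[noiseAlg w ((k : ℤ) - 1)] (U k) ∧ MemLp (U k) 2 μ) {k : ℕ}
    (hfin : S.inputCost μ w x0 U k ≠ ∞) :
    Tendsto (fun k => secondMoment μ 1 (S.traj w x0 U k) (S.traj w x0 U k)) atTop (𝓝 0) := by
  obtain ⟨L, C, hC, hbound⟩ := hobs.exists_sq_le hw hQ hR
  have hstage : Tendsto (S.stage μ w x0 U) atTop (𝓝 0) := by
    have h1 := ENNReal.tendsto_atTop_zero_of_tsum_ne_top hfin
    have h2 := (ENNReal.tendsto_toReal ENNReal.zero_ne_top).comp h1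
    rw [ENNReal.toReal_zero] at h2
    have h3 : Tendsto (fun j => S.stage μ w x0 U (j + k)) atTop (𝓝 0) :=
      h2.congr fun j => by
        rw [Function.comp_apply, ENNReal.toReal_ofReal (stage_nonneg hQ hR _), add_comm]
    exact (tendsto_add_atTop_iff_nat k).1 h3
  have hsum : Tendsto (fun k => C * ∑ j ∈ Finset.range L, S.stage μ w x0 U (k + j)) atTop
      (𝓝 0) := by
    have := (tendsto_finsetSum (Finset.range L) fun j _ =>
      (tendsto_add_atTop_iff_nat j).2 hstage).const_mul C
    simpa using this
  exact squeeze_zero (fun k => secondMoment_self_nonneg PosSemidef.one _)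
    (fun k => hbound x0 U hU k) hsum

/-- A larger delay conditions on less, and conditioning does not increase second moments; so each
difference in the sum is nonnegative. -/
theorem energy_nonneg (hw : IsWhiteNoise μ w) (hU : IsDelayedControl μ w d U)
    {P : Fin (d + 1) → Matrix (Fin n) (Fin n) ℝ} (hP : ∀ i, (P i).PosSemidef) (k : ℕ) :
    0 ≤ S.energy μ w x0 U P k := by
  refine add_nonneg (secondMoment_self_nonneg (hP _) _) (Finset.sum_nonneg fun i _ => ?_)
  have h1 : S.estimate μ w x0 U k (i + 1)
      =ᵐ[μ] μ[S.estimate μ w x0 U k i | noiseAlg w ((k : ℤ) - ((i : ℕ) + 1 : ℕ) - 1)] :=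
    (condExp_condExp_of_le (noiseAlg_mono (by push_cast; omega)) (hw.noiseAlg_le _)).symm
  rw [secondMoment_congr h1 h1, sub_nonneg]
  exact secondMoment_condExp_self_le (hw.noiseAlg_le _) (hP _)
    (memLp_estimate hw hU.undelayed k i)

theorem energy_le (hw : IsWhiteNoise μ w) (hU : IsDelayedControl μ w d U)
    {P : Fin (d + 1) → Matrix (Fin n) (Fin n) ℝ} (hP : ∀ i, (P i).PosSemidef) (k : ℕ) :
    S.energy μ w x0 U P k
      ≤ ∑ i, secondMoment μ (P i) (S.traj w x0 U k) (S.traj w x0 U k) := by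
  have hX2 := (traj_measurable_memLp (S := S) (x0 := x0) hw hU.undelayed k).2
  have hle : ∀ (j : ℕ) i, secondMoment μ (P i) (S.estimate μ w x0 U k j)
      (S.estimate μ w x0 U k j) ≤ secondMoment μ (P i) (S.traj w x0 U k) (S.traj w x0 U k) :=
    fun j i => secondMoment_condExp_self_le (hw.noiseAlg_le _) (hP i) hX2
  rw [energy, Fin.sum_univ_castSucc, add_comm]
  refine add_le_add (Finset.sum_le_sum fun i _ => ?_) (hle _ _)
  exact (sub_le_self _ (secondMoment_self_nonneg (hP _) _)).trans (hle _ _)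

theorem tendsto_energy (hw : IsWhiteNoise μ w) (hU : IsDelayedControl μ w d U)
    {P : Fin (d + 1) → Matrix (Fin n) (Fin n) ℝ} (hP : ∀ i, (P i).PosSemidef)
    (hstab : Tendsto (fun k => secondMoment μ 1 (S.traj w x0 U k) (S.traj w x0 U k)) atTop
      (𝓝 0)) :
    Tendsto (S.energy μ w x0 U P) atTop (𝓝 0) := by
  refine squeeze_zero (energy_nonneg hw hU hP) (energy_le hw hU hP) ?_
  rw [← Finset.sum_const_zero (s := (Finset.univ : Finset (Fin (d + 1))))]
  refine tendsto_finsetSum _ fun i _ => ?_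
  obtain ⟨C, -, hC⟩ := (PosDef.one (n := Fin n) (R := ℝ)).exists_quad_le (P i)
  refine squeeze_zero (fun k => secondMoment_self_nonneg (hP i) _)
    (fun k => secondMoment_mono (traj_measurable_memLp hw hU.undelayed k).2 hC) ?_
  simpa using hstab.const_mul C

/-- The energy balance over a finite horizon. -/
theorem sum_stage_add_energy (hw : IsWhiteNoise μ w) (hR : S.R.PosDef)
    (hU : IsDelayedControl μ w d U) {P : Fin (d + 1) → Matrix (Fin n) (Fin n) ℝ}
    (hP : ∀ i, (P i).PosSemidef) (hfix : S.riccatiMap P = P) (k T : ℕ) :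
    ∑ j ∈ Finset.range T, S.stage μ w x0 U (k + j) + S.energy μ w x0 U P (k + T)
      = S.energy μ w x0 U P k + ∑ j ∈ Finset.range T, S.deviation μ w x0 U P (k + j) := by
  induction T with
  | zero => simp
  | succ T ih =>
    have := energy_succ_add_stage (x0 := x0) hw hR hU hP (k + T)
    rw [hfix] at this
    rw [Finset.sum_range_succ, Finset.sum_range_succ, ← add_assoc k T 1]
    linarith

/-- The cost of a stabilizing control in terms of its deviation from the feedback law. -/
theorem inputCost_eq (hw : IsWhiteNoise μ w) (hQ : S.Q.PosSemidef) (hR : S.R.PosDef)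
    (hU : IsDelayedControl μ w d U) {P : Fin (d + 1) → Matrix (Fin n) (Fin n) ℝ}
    (hP : ∀ i, (P i).PosSemidef) (hfix : S.riccatiMap P = P)
    (hstab : Tendsto (fun k => secondMoment μ 1 (S.traj w x0 U k) (S.traj w x0 U k)) atTop
      (𝓝 0)) (k : ℕ) :
    S.inputCost μ w x0 U k = ENNReal.ofReal (S.energy μ w x0 U P k)
      + ∑' j : ℕ, ENNReal.ofReal (S.deviation μ w x0 U P (k + j)) := by
  -- Stability enters only here, to remove the terminal energy. Passing to the limit in [0, ∞]
  -- allows both series to diverge.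
  have h1 : Tendsto (fun T => ∑ j ∈ Finset.range T, ENNReal.ofReal (S.stage μ w x0 U (k + j))
      + ENNReal.ofReal (S.energy μ w x0 U P (k + T))) atTop
      (𝓝 (S.inputCost μ w x0 U k + ENNReal.ofReal 0)) := by
    refine (ENNReal.tendsto_nat_tsum _).add (ENNReal.tendsto_ofReal ?_)
    have := (tendsto_add_atTop_iff_nat k).2 (tendsto_energy hw hU hP hstab)
    simpa only [add_comm] using this
  have h2 : Tendsto (fun T => ENNReal.ofReal (S.energy μ w x0 U P k)
      + ∑ j ∈ Finset.range T, ENNReal.ofReal (S.deviation μ w x0 U P (k + j))) atTop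
      (𝓝 (ENNReal.ofReal (S.energy μ w x0 U P k)
        + ∑' j : ℕ, ENNReal.ofReal (S.deviation μ w x0 U P (k + j)))) :=
    tendsto_const_nhds.add (ENNReal.tendsto_nat_tsum _)
  rw [ENNReal.ofReal_zero, add_zero] at h1
  refine tendsto_nhds_unique h1 (h2.congr fun T => ?_)
  rw [← ENNReal.ofReal_sum_of_nonneg fun _ _ => stage_nonneg hQ hR _,
    ← ENNReal.ofReal_sum_of_nonneg fun _ _ => deviation_nonneg hR hP _,
    ← ENNReal.ofReal_add (energy_nonneg hw hU hP _)
      (Finset.sum_nonneg fun _ _ => deviation_nonneg hR hP _),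
    ← ENNReal.ofReal_add (Finset.sum_nonneg fun _ _ => stage_nonneg hQ hR _)
      (energy_nonneg hw hU hP _), sum_stage_add_energy hw hR hU hP hfix]

/-- A control that eventually obeys the feedback law has finite cost. -/
theorem inputCost_le_of_deviation_eq_zero (hw : IsWhiteNoise μ w) (hQ : S.Q.PosSemidef)
    (hR : S.R.PosDef) (hU : IsDelayedControl μ w d U)
    {P : Fin (d + 1) → Matrix (Fin n) (Fin n) ℝ} (hP : ∀ i, (P i).PosSemidef)
    (hfix : S.riccatiMap P = P) {k : ℕ} (hdev : ∀ j, S.deviation μ w x0 U P (k + j) = 0) :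
    S.inputCost μ w x0 U k ≤ ENNReal.ofReal (S.energy μ w x0 U P k) := by
  refine ENNReal.tsum_le_of_sum_range_le fun T => ?_
  rw [← ENNReal.ofReal_sum_of_nonneg fun _ _ => stage_nonneg hQ hR _]
  refine ENNReal.ofReal_le_ofReal ?_
  -- The terminal energy is dropped by its sign alone. Stability is not assumed, so it can be
  -- deduced from this bound.
  have h1 := sum_stage_add_energy (x0 := x0) hw hR hU hP hfix k T
  have h2 := energy_nonneg (S := S) (x0 := x0) hw hU hP (k + T)
  simp only [hdev, Finset.sum_const_zero, add_zero] at h1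
  linarith

theorem deviation_eq_zero_iff (hw : IsWhiteNoise μ w) (hR : S.R.PosDef)
    (hU : IsDelayedControl μ w d U) {P : Fin (d + 1) → Matrix (Fin n) (Fin n) ℝ}
    (hP : ∀ i, (P i).PosSemidef) (k : ℕ) :
    S.deviation μ w x0 U P k = 0 ↔
      U k =ᵐ[μ] fun ω => -(S.gain P *ᵥ S.estimate μ w x0 U k d ω) := by
  have hD2 : MemLp (fun ω => U k ω + S.gain P *ᵥ S.estimate μ w x0 U k d ω) 2 μ :=
    (hU k).2.add ((memLp_estimate hw hU.undelayed k d).mulVec _)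
  constructor
  · intro h
    filter_upwards [ae_eq_zero_of_secondMoment_eq_zero (inputWeight_posDef hR hP) hD2 h]
      with ω hω
    exact eq_neg_of_add_eq_zero_left hω
  · intro h
    have h0 : (fun ω => U k ω + S.gain P *ᵥ S.estimate μ w x0 U k d ω) =ᵐ[μ] fun _ => 0 := by
      filter_upwards [h] with ω hω
      rw [hω, neg_add_cancel]
    rw [deviation, secondMoment_congr h0 h0]
    simp [secondMoment]

end LQRData

/-! ### Feedback continuations and uniqueness of the Riccati solution. -/

namespace LQRData

variable {n m d : ℕ} {Ω : Type*} [MeasurableSpace Ω] {μ : Measure Ω} {w : ℕ → Ω → ℝ}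
  {S : LQRData n m} {x0 : Fin n → ℝ} {U : ℕ → Ω → Fin m → ℝ}

/-- The closed-loop trajectory under the inputs `U` before time `N` and the delayed feedback with
gain `K` from time `N` on. -/
noncomputable def closedLoop (S : LQRData n m) (μ : Measure Ω) (w : ℕ → Ω → ℝ) (d : ℕ)
    (K : Matrix (Fin m) (Fin n) ℝ) (x0 : Fin n → ℝ) (U : ℕ → Ω → Fin m → ℝ) (N : ℕ) :
    ℕ → Ω → Fin n → ℝ
  | 0 => fun _ => x0
  | k + 1 => fun ω => (S.A + w k ω • S.Abar) *ᵥ S.closedLoop μ w d K x0 U N k ω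
      + (S.B + w k ω • S.Bbar) *ᵥ (if k < N then U k ω else
        -(K *ᵥ (μ[S.closedLoop μ w d K x0 U N k | noiseAlg w ((k : ℤ) - d - 1)]) ω))

/-- Any delayed control can be continued by the delayed feedback law. -/
theorem IsDelayedControl.exists_feedback [IsProbabilityMeasure μ] (hw : IsWhiteNoise μ w)
    (hU : IsDelayedControl μ w d U) (S : LQRData n m) (K : Matrix (Fin m) (Fin n) ℝ)
    (x0 : Fin n → ℝ) (N : ℕ) :
    ∃ V, IsDelayedControl μ w d V ∧ (∀ k < N, V k = U k) ∧
      ∀ k, N ≤ k → V k = fun ω => -(K *ᵥ S.estimate μ w x0 V k d ω) := by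
  let V : ℕ → Ω → Fin m → ℝ := fun k ω => if k < N then U k ω else
    -(K *ᵥ (μ[S.closedLoop μ w d K x0 U N k | noiseAlg w ((k : ℤ) - d - 1)]) ω)
  have htraj : ∀ k, S.closedLoop μ w d K x0 U N k = S.traj w x0 V k := fun k => by
    induction k with
    | zero => rfl
    | succ k ih =>
      have h : S.closedLoop μ w d K x0 U N (k + 1)
        = fun ω => (S.A + w k ω • S.Abar) *ᵥ S.closedLoop μ w d K x0 U N k ω
          + (S.B + w k ω • S.Bbar) *ᵥ V k ω := rfl
      rw [h, ih, traj]
  have hlt : ∀ k < N, V k = U k := fun k hk => by simp [V, hk]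
  have hge : ∀ k, N ≤ k → V k = fun ω => -(K *ᵥ S.estimate μ w x0 V k d ω) := fun k hk => by
    funext ω
    change (if k < N then U k ω else _) = _
    rw [if_neg (not_lt.2 hk), htraj]
    rfl
  refine ⟨V, fun k => ?_, hlt, hge⟩
  induction k using Nat.strong_induction_on with
  | _ k ih =>
    rcases lt_or_ge k N with hk | hk
    · rw [hlt k hk]
      exact hU k
    · have hmul : Measurable fun x => K *ᵥ x :=
        (by fun_prop : Continuous fun x => K *ᵥ x).measurable
      -- Integrability of the state needs all inputs to be controls, while the induction knows only
      -- those before `k`; truncation does not change the state at time `k`.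
      let V' : ℕ → Ω → Fin m → ℝ := fun j => if j < k then V j else 0
      have hV' : IsDelayedControl μ w d V' := fun j => by
        by_cases hj : j < k
        · simpa only [V', hj, if_true] using ih j hj
        · simp only [V', hj, if_false]
          exact ⟨measurable_const, MemLp.zero⟩
      have hX2 : MemLp (S.traj w x0 V k) 2 μ := by
        rw [traj_congr S w x0 (U := V) (U' := V') (N := k)
          (fun j hj => by simp only [V', hj, if_true]) le_rfl]
        exact (traj_measurable_memLp hw hV'.undelayed k).2
      rw [hge k hk]
      refine ⟨(hmul.comp ?_).neg, ((hX2.condExp one_le_two).mulVec K).neg⟩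
      exact stronglyMeasurable_condExp.measurable

theorem traj_congr_ae (S : LQRData n m) (x0 : Fin n → ℝ) {U U' : ℕ → Ω → Fin m → ℝ} {N : ℕ}
    (h : ∀ k < N, U k =ᵐ[μ] U' k) {k : ℕ} (hk : k ≤ N) :
    S.traj w x0 U k =ᵐ[μ] S.traj w x0 U' k := by
  induction k with
  | zero => rfl
  | succ k ih =>
    filter_upwards [ih (by omega), h k (by omega)] with ω h1 h2
    simp only [traj, h1, h2]

theorem energy_congr (S : LQRData n m) (x0 : Fin n → ℝ) {U U' : ℕ → Ω → Fin m → ℝ} {k : ℕ}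
    (h : ∀ j < k, U j = U' j) (P : Fin (d + 1) → Matrix (Fin n) (Fin n) ℝ) :
    S.energy μ w x0 U P k = S.energy μ w x0 U' P k := by
  simp only [energy, estimate, traj_congr S w x0 h le_rfl]

theorem stage_congr (S : LQRData n m) (x0 : Fin n → ℝ) {U U' : ℕ → Ω → Fin m → ℝ} {k : ℕ}
    (h : ∀ j ≤ k, U j = U' j) : S.stage μ w x0 U k = S.stage μ w x0 U' k := by
  simp only [stage, traj_congr S w x0 (fun j hj => h j (le_of_lt hj)) (le_refl k), h k le_rfl]

theorem estimate_initial [IsProbabilityMeasure μ] (hw : IsWhiteNoise μ w) (i : ℕ) :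
    S.estimate μ w x0 U 0 i = fun _ => x0 :=
  condExp_const (hw.noiseAlg_le _) x0

theorem energy_initial [IsProbabilityMeasure μ] (hw : IsWhiteNoise μ w)
    (P : Fin (d + 1) → Matrix (Fin n) (Fin n) ℝ) :
    S.energy μ w x0 U P 0 = x0 ⬝ᵥ P (Fin.last d) *ᵥ x0 := by
  simp [energy, estimate_initial hw, secondMoment_const]

theorem deviation_initial [IsProbabilityMeasure μ] (hw : IsWhiteNoise μ w)
    (P : Fin (d + 1) → Matrix (Fin n) (Fin n) ℝ) (h0 : U 0 = 0) :
    S.deviation μ w x0 U P 0 = (S.gain P *ᵥ x0) ⬝ᵥ S.inputWeight P *ᵥ (S.gain P *ᵥ x0) := by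
  simp [deviation, estimate_initial hw, h0, secondMoment_const]

variable [IsProbabilityMeasure μ]

/-- The feedback law from time `N` on stabilizes the system and attains the energy. -/
theorem ExactlyObservable.exists_optimal_feedback (hobs : S.ExactlyObservable μ w)
    (hw : IsWhiteNoise μ w) (hQ : S.Q.PosSemidef) (hR : S.R.PosDef)
    (hU : IsDelayedControl μ w d U) {P : Fin (d + 1) → Matrix (Fin n) (Fin n) ℝ}
    (hP : ∀ i, (P i).PosSemidef) (hfix : S.riccatiMap P = P) (x0 : Fin n → ℝ) (N : ℕ) :
    ∃ V, IsDelayedControl μ w d V ∧ (∀ k < N, V k = U k) ∧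
      Tendsto (fun k => secondMoment μ 1 (S.traj w x0 V k) (S.traj w x0 V k)) atTop (𝓝 0) ∧
      ∀ k, N ≤ k → S.deviation μ w x0 V P k = 0 := by
  obtain ⟨V, hV, hlt, hge⟩ := hU.exists_feedback hw S (S.gain P) x0 N
  have hdev : ∀ k, N ≤ k → S.deviation μ w x0 V P k = 0 := fun k hk =>
    (deviation_eq_zero_iff hw hR hV hP k).2 (by rw [← hge k hk])
  refine ⟨V, hV, hlt, ?_, hdev⟩
  refine hobs.tendsto_of_inputCost_ne_top hw hQ hR hV.undelayed (k := N) ?_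
  exact ne_top_of_le_ne_top ENNReal.ofReal_ne_top
    (inputCost_le_of_deviation_eq_zero hw hQ hR hV hP hfix fun j => hdev _ (Nat.le_add_right _ _))

/-- The feedback of `P`, applied from time 0, costs exactly x'P^d x; in the cost formula of `P'` the
same control costs x'P'^d x plus deviations. -/
theorem ExactlyObservable.quad_last_le (hobs : S.ExactlyObservable μ w)
    (hw : IsWhiteNoise μ w) (hQ : S.Q.PosSemidef) (hR : S.R.PosDef)
    {P P' : Fin (d + 1) → Matrix (Fin n) (Fin n) ℝ} (hP : ∀ i, (P i).PosSemidef)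
    (hfix : S.riccatiMap P = P) (hP' : ∀ i, (P' i).PosSemidef) (hfix' : S.riccatiMap P' = P')
    (x : Fin n → ℝ) :
    x ⬝ᵥ P' (Fin.last d) *ᵥ x ≤ x ⬝ᵥ P (Fin.last d) *ᵥ x := by
  obtain ⟨V, hV, -, hstab, hdev⟩ := hobs.exists_optimal_feedback hw hQ hR
    isDelayedControl_zero hP hfix x 0
  have h1 := inputCost_eq hw hQ hR hV hP hfix hstab 0
  have h2 := inputCost_eq hw hQ hR hV hP' hfix' hstab 0
  simp only [hdev _ (Nat.zero_le _), ENNReal.ofReal_zero, tsum_zero, add_zero,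
    energy_initial hw] at h1
  rw [h1, energy_initial hw] at h2
  exact (ENNReal.ofReal_le_ofReal_iff ((hP _).quad_nonneg x)).1 (h2 ▸ le_self_add)

/-- The same comparison for the control that vanishes at time 0 and follows the feedback of `P` from
time 1. Its single nonzero deviation raises x'P^d x to x'P^{d-1}x. -/
theorem ExactlyObservable.quad_pred_last_le
    (hobs : S.ExactlyObservable μ w)
    (hw : IsWhiteNoise μ w) (hQ : S.Q.PosSemidef) (hR : S.R.PosDef)
    {P P' : Fin (d + 1 + 1) → Matrix (Fin n) (Fin n) ℝ} (hP : ∀ i, (P i).PosSemidef)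
    (hfix : S.riccatiMap P = P) (hP' : ∀ i, (P' i).PosSemidef) (hfix' : S.riccatiMap P' = P')
    (x : Fin n → ℝ) :
    x ⬝ᵥ P' (Fin.last d).castSucc *ᵥ x ≤ x ⬝ᵥ P (Fin.last d).castSucc *ᵥ x := by
  obtain ⟨V, hV, hlt, hstab, hdev⟩ := hobs.exists_optimal_feedback (d := d + 1) hw hQ hR
    isDelayedControl_zero hP hfix x 1
  have hV0 : V 0 = 0 := hlt 0 one_pos
  have hquad := quad_riccatiMap_pred_last hR hP x
  have hquad' := quad_riccatiMap_pred_last hR hP' x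
  rw [hfix] at hquad
  rw [hfix'] at hquad'
  have h1 := inputCost_eq hw hQ hR hV hP hfix hstab 0
  have h2 := inputCost_eq hw hQ hR hV hP' hfix' hstab 0
  simp only [zero_add] at h1 h2
  rw [tsum_eq_single 0 fun j hj => by
      rw [hdev j (Nat.one_le_iff_ne_zero.2 hj), ENNReal.ofReal_zero],
    ← ENNReal.ofReal_add (energy_nonneg hw hV hP _) (deviation_nonneg hR hP _),
    energy_initial hw, deviation_initial hw P hV0, ← hquad] at h1
  have h3 := ENNReal.le_tsum (f := fun j => ENNReal.ofReal (S.deviation μ w x V P' j)) 0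
  have h4 : ENNReal.ofReal (S.energy μ w x V P' 0) + ENNReal.ofReal (S.deviation μ w x V P' 0)
      ≤ S.inputCost μ w x V 0 := by
    rw [h2]
    gcongr
  rw [← ENNReal.ofReal_add (energy_nonneg hw hV hP' _) (deviation_nonneg hR hP' _),
    energy_initial hw, deviation_initial hw P' hV0, ← hquad', h1] at h4
  exact (ENNReal.ofReal_le_ofReal_iff ((hP _).quad_nonneg x)).1 h4

/-- The Riccati equations have at most one positive semidefinite solution. -/
theorem ExactlyObservable.riccati_unique (hobs : S.ExactlyObservable μ w) (hd : 0 < d)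
    (hw : IsWhiteNoise μ w) (hQ : S.Q.PosSemidef) (hR : S.R.PosDef)
    {P P' : Fin (d + 1) → Matrix (Fin n) (Fin n) ℝ} (hP : ∀ i, (P i).PosSemidef)
    (hfix : S.riccatiMap P = P) (hP' : ∀ i, (P' i).PosSemidef) (hfix' : S.riccatiMap P' = P') :
    P = P' := by
  obtain ⟨d, rfl⟩ : ∃ e, d = e + 1 := ⟨d - 1, by omega⟩
  have hlast : P (Fin.last _) = P' (Fin.last _) :=
    eq_of_quad_eq (hP _).transpose_eq (hP' _).transpose_eq fun x =>
      le_antisymm (hobs.quad_last_le hw hQ hR hP' hfix' hP hfix x)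
        (hobs.quad_last_le hw hQ hR hP hfix hP' hfix' x)
  have hpred : P (Fin.last d).castSucc = P' (Fin.last d).castSucc :=
    eq_of_quad_eq (hP _).transpose_eq (hP' _).transpose_eq fun x =>
      le_antisymm (hobs.quad_pred_last_le hw hQ hR hP' hfix' hP hfix x)
        (hobs.quad_pred_last_le hw hQ hR hP hfix hP' hfix' x)
  have hstep : ∀ {P : Fin (d + 1 + 1) → Matrix (Fin n) (Fin n) ℝ}, S.riccatiMap P = P →
      ∀ i : Fin (d + 1), P i.castSucc
        = S.Aᵀ * P i.succ * S.A + S.Abarᵀ * P 0 * S.Abar + S.Q := fun h i => by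
    have := congrFun h i.castSucc
    rw [riccatiMap_castSucc] at this
    exact this.symm
  -- `P 0` enters the recursion for the weights only through this product, which the equation for i
  -- = d expresses by P^{d-1} and P^d.
  have hnoise : S.Abarᵀ * P 0 * S.Abar = S.Abarᵀ * P' 0 * S.Abar := by
    have h1 := hstep hfix (Fin.last d)
    have h2 := hstep hfix' (Fin.last d)
    rw [Fin.succ_last] at h1 h2
    rw [hpred, h2, hlast] at h1
    exact (add_left_cancel (add_right_cancel h1)).symm
  funext i
  induction i using Fin.reverseInduction with
  | last => exact hlast
  | cast i ih => rw [hstep hfix, hstep hfix', ih, hnoise]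

end LQRData

/-! ### Existence: the Riccati recursion started at zero. -/

namespace LQRData

variable {n m d : ℕ} {S : LQRData n m}

variable (S d) in
/-- The Riccati recursion started at zero, that is, the weights of the finite-horizon problems. -/
noncomputable def riccatiIter (T : ℕ) : Fin (d + 1) → Matrix (Fin n) (Fin n) ℝ :=
  S.riccatiMap^[T] 0

theorem riccatiIter_succ (T : ℕ) :
    S.riccatiIter d (T + 1) = S.riccatiMap (S.riccatiIter d T) :=
  Function.iterate_succ_apply' _ _ _

theorem riccatiIter_posSemidef (hQ : S.Q.PosSemidef) (hR : S.R.PosDef) (T : ℕ)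
    (i : Fin (d + 1)) : (S.riccatiIter d T i).PosSemidef := by
  induction T generalizing i with
  | zero => exact PosSemidef.zero
  | succ T ih => rw [riccatiIter_succ]; exact riccatiMap_posSemidef hQ hR ih i

theorem riccatiIter_monotone (hQ : S.Q.PosSemidef) (hR : S.R.PosDef) (i : Fin (d + 1))
    (x : Fin n → ℝ) : Monotone fun T => x ⬝ᵥ S.riccatiIter d T i *ᵥ x := by
  refine monotone_nat_of_le_succ fun T => ?_
  induction T generalizing i x with
  | zero =>
    have : x ⬝ᵥ S.riccatiIter d 0 i *ᵥ x = 0 := by simp [riccatiIter]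
    rw [this]
    exact (riccatiIter_posSemidef hQ hR _ _).quad_nonneg x
  | succ T ih =>
    rw [riccatiIter_succ (T + 1), riccatiIter_succ T] at *
    exact riccatiMap_mono hR (riccatiIter_posSemidef hQ hR T)
      (by simpa only [riccatiIter_succ] using ih) i x

theorem continuousAt_gain (hR : S.R.PosDef) {P : Fin (d + 1) → Matrix (Fin n) (Fin n) ℝ}
    (hP : ∀ i, (P i).PosSemidef) :
    ContinuousAt (fun P : Fin (d + 1) → Matrix (Fin n) (Fin n) ℝ => S.gain P) P := by
  have hdet : (S.inputWeight P).det ≠ 0 := (inputWeight_posDef hR hP).det_pos.ne'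
  have hweight : Continuous fun P : Fin (d + 1) → Matrix (Fin n) (Fin n) ℝ => S.inputWeight P := by
    unfold inputWeight
    fun_prop
  have hinv : ContinuousAt
      (fun P : Fin (d + 1) → Matrix (Fin n) (Fin n) ℝ => (S.inputWeight P)⁻¹) P := by
    refine ContinuousAt.comp (g := fun M : Matrix (Fin m) (Fin m) ℝ => M⁻¹)
      (continuousAt_matrix_inv _ ?_) hweight.continuousAt
    rw [Ring.inverse_eq_inv']
    exact continuousAt_inv₀ hdet
  have hmul : Continuous fun p : Matrix (Fin m) (Fin m) ℝ × Matrix (Fin m) (Fin n) ℝ =>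
      p.1 * p.2 := by fun_prop
  have hright : Continuous fun P : Fin (d + 1) → Matrix (Fin n) (Fin n) ℝ =>
      S.Bᵀ * P (Fin.last d) * S.A + S.Bbarᵀ * P 0 * S.Abar := by fun_prop
  exact hmul.continuousAt.comp (hinv.prodMk hright.continuousAt)

theorem continuousAt_riccatiMap (hR : S.R.PosDef)
    {P : Fin (d + 1) → Matrix (Fin n) (Fin n) ℝ} (hP : ∀ i, (P i).PosSemidef) :
    ContinuousAt (S.riccatiMap (d := d)) P := by
  refine continuousAt_pi.2 fun i => ?_
  induction i using Fin.lastCases with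
  | last =>
    simp only [riccatiMap_last]
    have : Continuous fun p : Matrix (Fin m) (Fin n) ℝ × (Fin (d + 1) → Matrix (Fin n) (Fin n) ℝ) =>
        S.controlledStep p.1 p.2 := by
      unfold controlledStep
      have hA : Continuous fun p : Matrix (Fin m) (Fin n) ℝ ×
          (Fin (d + 1) → Matrix (Fin n) (Fin n) ℝ) => S.A - S.B * p.1 :=
        continuous_const.sub (continuous_const.matrix_mul continuous_fst)
      have hAbar : Continuous fun p : Matrix (Fin m) (Fin n) ℝ ×
          (Fin (d + 1) → Matrix (Fin n) (Fin n) ℝ) => S.Abar - S.Bbar * p.1 :=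
        continuous_const.sub (continuous_const.matrix_mul continuous_fst)
      have hP : ∀ i, Continuous fun p : Matrix (Fin m) (Fin n) ℝ ×
          (Fin (d + 1) → Matrix (Fin n) (Fin n) ℝ) => p.2 i :=
        fun i => (continuous_apply i).comp continuous_snd
      exact ((((hA.matrix_transpose.matrix_mul (hP _)).matrix_mul hA).add
        ((hAbar.matrix_transpose.matrix_mul (hP _)).matrix_mul hAbar)).add
        ((continuous_fst.matrix_transpose.matrix_mul continuous_const).matrix_mul
          continuous_fst)).add continuous_const
    exact ContinuousAt.comp
      (g := fun p : Matrix (Fin m) (Fin n) ℝ × (Fin (d + 1) → Matrix (Fin n) (Fin n) ℝ) =>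
        S.controlledStep p.1 p.2)
      (f := fun P : Fin (d + 1) → Matrix (Fin n) (Fin n) ℝ => (S.gain P, P))
      this.continuousAt ((continuousAt_gain hR hP).prodMk continuousAt_id)
  | cast i =>
    simp only [riccatiMap_castSucc]
    have : Continuous fun P : Fin (d + 1) → Matrix (Fin n) (Fin n) ℝ =>
        S.uncontrolledStep (P i.succ) (P 0) := by
      unfold uncontrolledStep
      fun_prop
    exact this.continuousAt

/-- A bounded Riccati recursion converges to a positive semidefinite fixed point. -/
theorem exists_fixedPoint_of_bounded (hQ : S.Q.PosSemidef) (hR : S.R.PosDef)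
    (hbdd : ∀ (i : Fin (d + 1)) (x : Fin n → ℝ), ∃ C, ∀ T, x ⬝ᵥ S.riccatiIter d T i *ᵥ x ≤ C) :
    ∃ P : Fin (d + 1) → Matrix (Fin n) (Fin n) ℝ,
      (∀ i, (P i).PosSemidef) ∧ S.riccatiMap P = P := by
  have hq : ∀ (i : Fin (d + 1)) (x : Fin n → ℝ), ∃ l,
      Tendsto (fun T => x ⬝ᵥ S.riccatiIter d T i *ᵥ x) atTop (𝓝 l) := fun i x => by
    obtain ⟨C, hC⟩ := hbdd i x
    exact ⟨_, tendsto_atTop_ciSup (riccatiIter_monotone hQ hR i x)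
      ⟨C, Set.forall_mem_range.2 hC⟩⟩
  choose q hq using hq
  -- Monotonicity gives limits of quadratic forms only; polarization recovers the entries of the
  -- limit.
  let P : Fin (d + 1) → Matrix (Fin n) (Fin n) ℝ := fun i => Matrix.of fun a b =>
    (q i (Pi.single a 1 + Pi.single b 1) - q i (Pi.single a 1) - q i (Pi.single b 1)) / 2
  have hlim : Tendsto (S.riccatiIter d) atTop (𝓝 P) := by
    refine tendsto_pi_nhds.2 fun i => tendsto_pi_nhds.2 fun a => tendsto_pi_nhds.2 fun b => ?_
    simp only [entry_eq_of_transpose_eq (riccatiIter_posSemidef hQ hR _ i).transpose_eq a b]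
    exact (((hq i _).sub (hq i _)).sub (hq i _)).div_const 2
  have hlim' : ∀ i, Tendsto (fun T => S.riccatiIter d T i) atTop (𝓝 (P i)) :=
    fun i => tendsto_pi_nhds.1 hlim i
  have hP : ∀ i, (P i).PosSemidef := fun i => by
    refine posSemidef_of_transpose_eq ?_ fun x => ?_
    · have hc : Continuous fun M : Matrix (Fin n) (Fin n) ℝ => Mᵀ := by fun_prop
      refine tendsto_nhds_unique ((hc.tendsto _).comp (hlim' i)) ((hlim' i).congr fun T => ?_)
      exact (riccatiIter_posSemidef hQ hR T i).transpose_eq.symm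
    · have hc : Continuous fun M : Matrix (Fin n) (Fin n) ℝ => x ⬝ᵥ M *ᵥ x := by fun_prop
      exact ge_of_tendsto' ((hc.tendsto _).comp (hlim' i))
        fun T => (riccatiIter_posSemidef hQ hR T i).quad_nonneg x
  refine ⟨P, hP, ?_⟩
  refine tendsto_nhds_unique ((continuousAt_riccatiMap hR hP).tendsto.comp hlim)
    (((tendsto_add_atTop_iff_nat 1).2 hlim).congr fun T => ?_)
  exact riccatiIter_succ T

variable {Ω : Type*} [MeasurableSpace Ω] {μ : Measure Ω} [IsProbabilityMeasure μ] {w : ℕ → Ω → ℝ}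
  {x0 : Fin n → ℝ} {U : ℕ → Ω → Fin m → ℝ}

/-- The weights of the finite-horizon problem bound the finite-horizon cost from below. -/
theorem energy_riccatiIter_le (hw : IsWhiteNoise μ w) (hQ : S.Q.PosSemidef) (hR : S.R.PosDef)
    (hU : IsDelayedControl μ w d U) (T k : ℕ) :
    S.energy μ w x0 U (S.riccatiIter d T) k
      ≤ ∑ j ∈ Finset.range T, S.stage μ w x0 U (k + j) := by
  induction T generalizing k with
  | zero => exact (energy_zero_weight k).le
  | succ T ih =>
    have h1 := energy_succ_add_stage (x0 := x0) hw hR hU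
      (riccatiIter_posSemidef hQ hR T) k
    have h2 := deviation_nonneg (μ := μ) (w := w) (x0 := x0) (U := U) hR
      (riccatiIter_posSemidef (d := d) hQ hR T) k
    rw [sum_range_succ_shift, riccatiIter_succ]
    linarith [ih (k + 1)]

/-- The Riccati recursion is bounded if every initial state admits an input sequence, vanishing at
time zero, of finite cost. -/
theorem riccatiIter_bounded (hd : 0 < d) (hw : IsWhiteNoise μ w) (hQ : S.Q.PosSemidef)
    (hR : S.R.PosDef)
    (hfin : ∀ x0, ∃ U, IsDelayedControl μ w d U ∧ U 0 = 0 ∧ S.inputCost μ w x0 U 0 ≠ ∞)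
    (i : Fin (d + 1)) (x : Fin n → ℝ) : ∃ C, ∀ T, x ⬝ᵥ S.riccatiIter d T i *ᵥ x ≤ C := by
  obtain ⟨d, rfl⟩ : ∃ e, d = e + 1 := ⟨d - 1, by omega⟩
  choose U hU hU0 hfinU using hfin
  have hlast : ∀ x T, x ⬝ᵥ S.riccatiIter (d + 1) T (Fin.last _) *ᵥ x
      ≤ (S.inputCost μ w x (U x) 0).toReal := fun x T => by
    rw [← energy_initial (S := S) (U := U x) hw]
    exact (energy_riccatiIter_le hw hQ hR (hU x) T 0).trans
      (sum_stage_le_toReal_inputCost hQ hR (hfinU x) T)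
  -- Since the input vanishes at time 0, its deviation there is the excess of this weight over the
  -- last one, and the finite cost pays for both.
  have hpred : ∀ x T, x ⬝ᵥ S.riccatiIter (d + 1) (T + 1) (Fin.last d).castSucc *ᵥ x
      ≤ (S.inputCost μ w x (U x) 0).toReal := fun x T => by
    have h1 := energy_succ_add_stage (x0 := x) hw hR (hU x) (riccatiIter_posSemidef hQ hR T) 0
    have h2 := energy_riccatiIter_le (x0 := x) hw hQ hR (hU x) T (0 + 1)
    have h3 := sum_stage_le_toReal_inputCost hQ hR (hfinU x) (T + 1)
    rw [sum_range_succ_shift] at h3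
    rw [energy_initial hw, deviation_initial hw _ (hU0 x)] at h1
    rw [riccatiIter_succ, quad_riccatiMap_pred_last hR (riccatiIter_posSemidef hQ hR T)]
    linarith
  -- The other two terms of the uncontrolled step are nonnegative. This bound on the noise term is
  -- what the descent from the last weight needs.
  have hnoise : ∀ x T, (S.Abar *ᵥ x) ⬝ᵥ S.riccatiIter (d + 1) T 0 *ᵥ (S.Abar *ᵥ x)
      ≤ (S.inputCost μ w x (U x) 0).toReal := fun x T => by
    have h1 := hpred x T
    rw [riccatiIter_succ, riccatiMap_castSucc, quad_uncontrolledStep] at h1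
    have h2 := (riccatiIter_posSemidef hQ hR T (Fin.last d).succ).quad_nonneg (S.A *ᵥ x)
    linarith [hQ.quad_nonneg x]
  induction i using Fin.reverseInduction generalizing x with
  | last => exact ⟨_, hlast x⟩
  | cast i ih =>
    obtain ⟨C, hC⟩ := ih (S.A *ᵥ x)
    refine ⟨C + (S.inputCost μ w x (U x) 0).toReal + x ⬝ᵥ S.Q *ᵥ x, fun T => ?_⟩
    refine (riccatiIter_monotone hQ hR _ x (Nat.le_succ T)).trans ?_
    simp only [Nat.succ_eq_add_one]
    rw [riccatiIter_succ, riccatiMap_castSucc, quad_uncontrolledStep]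
    gcongr
    · exact hC T
    · exact hnoise x T

/-- Positive semidefinite fixed points of the Riccati operator are positive definite. -/
theorem ExactlyObservable.posDef_of_fixedPoint (hobs : S.ExactlyObservable μ w)
    (hw : IsWhiteNoise μ w) (hQ : S.Q.PosSemidef) (hR : S.R.PosDef)
    {P : Fin (d + 1) → Matrix (Fin n) (Fin n) ℝ} (hP : ∀ i, (P i).PosSemidef)
    (hfix : S.riccatiMap P = P) (i : Fin (d + 1)) : (P i).PosDef := by
  obtain ⟨L, C, hC, hbound⟩ := hobs.exists_sq_le hw hQ hR
  -- This quadratic form dominates the cost over `L` steps of the feedback started at `x`, which by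
  -- observability dominates a multiple of |x|².
  have hlast : ∀ x, x ≠ 0 → 0 < x ⬝ᵥ P (Fin.last d) *ᵥ x := fun x hx => by
    obtain ⟨V, hV, -, -, hdev⟩ := hobs.exists_optimal_feedback hw hQ hR
      isDelayedControl_zero hP hfix x 0
    have h1 := sum_stage_add_energy (x0 := x) hw hR hV hP hfix 0 L
    have h2 := energy_nonneg (S := S) (x0 := x) hw hV hP (0 + L)
    have h3 := hbound x V hV.undelayed 0
    have h4 : secondMoment μ 1 (S.traj w x V 0) (S.traj w x V 0) = x ⬝ᵥ (1 : Matrix _ _ ℝ) *ᵥ x :=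
      secondMoment_const _ _ _
    simp only [hdev _ (Nat.zero_le _), Finset.sum_const_zero, add_zero, energy_initial hw] at h1
    have h5 := (PosDef.one (n := Fin n) (R := ℝ)).quad_pos hx
    rw [h4] at h3
    have h6 : C * ∑ j ∈ Finset.range L, S.stage μ w x V (0 + j)
        ≤ C * (x ⬝ᵥ P (Fin.last d) *ᵥ x) := mul_le_mul_of_nonneg_left (by linarith) hC
    exact pos_of_mul_pos_right (h5.trans_le (h3.trans h6)) hC
  -- The last weight is the uncontrolled step minus a square, while the others are uncontrolled
  -- steps of weights that are larger by induction.
  have hle : ∀ i x, x ⬝ᵥ P (Fin.last d) *ᵥ x ≤ x ⬝ᵥ P i *ᵥ x := fun i => by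
    induction i using Fin.reverseInduction with
    | last => exact fun x => le_rfl
    | cast i ih =>
      intro x
      have h1 := quad_controlledStep_gain hR hP x
      have h2 := (inputWeight_posDef hR hP).posSemidef.quad_nonneg (S.gain P *ᵥ x)
      have h3 := ih (S.A *ᵥ x)
      rw [← riccatiMap_last, hfix, quad_uncontrolledStep] at h1
      rw [← congrFun hfix i.castSucc, riccatiMap_castSucc, quad_uncontrolledStep]
      linarith
  exact posDef_of_transpose_eq (hP i).transpose_eq fun x hx => (hlast x hx).trans_le (hle i x)

end LQRData

/-! ### Back to the original problem: optimality, value function, solvability. -/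

namespace LQRData

variable {n m d : ℕ} {Ω : Type*} [MeasurableSpace Ω] {μ : Measure Ω}
  {w : ℕ → Ω → ℝ} {S : LQRData n m} {x0 : Fin n → ℝ} {u0 : Fin d → Fin m → ℝ}
  {u v : ℕ → Ω → Fin m → ℝ}

theorem predictor_eq_estimate (k i : ℕ) {t : ℤ} (ht : t = (k : ℤ) - i - 1) :
    S.predictor μ w x0 u0 u k t = S.estimate μ w x0 (delayedInput u0 u) k i := by
  rw [predictor, estimate, ht, state_eq_traj]

theorem admissible_iff : S.Admissible μ w x0 u0 u ↔ IsControl μ w u ∧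
    Tendsto (fun k => secondMoment μ 1 (S.traj w x0 (delayedInput u0 u) k)
      (S.traj w x0 (delayedInput u0 u) k)) atTop (𝓝 0) := by
  simp only [Admissible, secondMoment, one_mulVec, state_eq_traj]

/-- The predictor in the law for `u k` involves only inputs acting before time k + d, so the law
determines the control recursively, up to null sets. -/
theorem eq_of_feedback {K : Matrix (Fin m) (Fin n) ℝ}
    (hu : ∀ k, d ≤ k → u (k - d) =ᵐ[μ]
      fun ω => -(K *ᵥ S.predictor μ w x0 u0 u k ((k : ℤ) - d - 1) ω))
    (hv : ∀ k, d ≤ k → v (k - d) =ᵐ[μ]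
      fun ω => -(K *ᵥ S.predictor μ w x0 u0 v k ((k : ℤ) - d - 1) ω)) (k : ℕ) :
    v k =ᵐ[μ] u k := by
  induction k using Nat.strong_induction_on with
  | _ k ih =>
    have h1 := hu (k + d) (Nat.le_add_left _ _)
    have h2 := hv (k + d) (Nat.le_add_left _ _)
    rw [Nat.add_sub_cancel, predictor_eq_estimate (k + d) d rfl] at h1 h2
    have hin : ∀ j < k + d, delayedInput u0 v j =ᵐ[μ] delayedInput u0 u j := fun j hj => by
      by_cases hjd : j < d
      · simp only [delayedInput, hjd, dif_pos]
        rfl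
      · simp only [delayedInput, hjd, dif_neg, not_false_eq_true]
        exact ih _ (by omega)
    have h3 : S.estimate μ w x0 (delayedInput u0 v) (k + d) d
        =ᵐ[μ] S.estimate μ w x0 (delayedInput u0 u) (k + d) d :=
      condExp_congr_ae (traj_congr_ae S x0 hin le_rfl)
    filter_upwards [h1, h2, h3] with ω e1 e2 e3
    rw [e1, e2, e3]

variable [IsProbabilityMeasure μ]

theorem stageCost_eq (hw : IsWhiteNoise μ w) (hQ : S.Q.PosSemidef) (hR : S.R.PosDef)
    (hu : IsControl μ w u) (k : ℕ) :
    S.stageCost μ w x0 u0 u k = ENNReal.ofReal (S.stage μ w x0 (delayedInput u0 u) k) := by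
  have hU := hu.isDelayedControl u0
  have hX2 := (traj_measurable_memLp (S := S) (x0 := x0) hw hU.undelayed k).2
  have i1 := hX2.integrable_bilin hX2 S.Q
  have i2 := (hU k).2.integrable_bilin (hU k).2 S.R
  have hsum : S.stage μ w x0 (delayedInput u0 u) k = ∫ ω,
      (S.traj w x0 (delayedInput u0 u) k ω ⬝ᵥ S.Q *ᵥ S.traj w x0 (delayedInput u0 u) k ω
        + delayedInput u0 u k ω ⬝ᵥ S.R *ᵥ delayedInput u0 u k ω) ∂μ :=
    (integral_add i1 i2).symm
  have hlint := ofReal_integral_eq_lintegral_ofReal (i1.add i2)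
    (ae_of_all _ fun ω => add_nonneg (hQ.quad_nonneg _) (hR.posSemidef.quad_nonneg _))
  simp only [Pi.add_apply] at hlint
  rw [hsum, hlint]
  simp only [stageCost, state_eq_traj]

theorem costFrom_eq (hw : IsWhiteNoise μ w) (hQ : S.Q.PosSemidef) (hR : S.R.PosDef)
    (hu : IsControl μ w u) (k : ℕ) :
    S.costFrom μ w x0 u0 u k = S.inputCost μ w x0 (delayedInput u0 u) k := by
  simp only [costFrom, inputCost, stageCost_eq hw hQ hR hu]

/-- Every control can be continued optimally from any time `k ≥ d` on. -/
theorem ExactlyObservable.exists_optimal_continuation (hobs : S.ExactlyObservable μ w)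
    (hw : IsWhiteNoise μ w) (hQ : S.Q.PosSemidef) (hR : S.R.PosDef) (hu : IsControl μ w u)
    {P : Fin (d + 1) → Matrix (Fin n) (Fin n) ℝ} (hP : ∀ i, (P i).PosSemidef)
    (hfix : S.riccatiMap P = P) (x0 : Fin n → ℝ) (u0 : Fin d → Fin m → ℝ) {k : ℕ} (hk : d ≤ k) :
    ∃ v, S.Admissible μ w x0 u0 v ∧ (∀ j, j + d < k → v j = u j) ∧
      ∀ j, S.deviation μ w x0 (delayedInput u0 v) P (k + j) = 0 := by
  obtain ⟨V, hV, hlt, hstab, hdev⟩ := hobs.exists_optimal_feedback hw hQ hR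
    (hu.isDelayedControl u0) hP hfix x0 k
  obtain ⟨hv, hvV⟩ := hV.exists_eq_delayedInput (u0 := u0) fun j => by
    rw [hlt j (j.2.trans_le hk)]
    simp [delayedInput]
  refine ⟨fun j => V (j + d), admissible_iff.2 ⟨hv, by rwa [hvV]⟩, fun j hj => ?_, fun j => ?_⟩
  · change V (j + d) = u j
    rw [hlt _ hj]
    simp [delayedInput]
  · rw [hvV]
    exact hdev _ (Nat.le_add_right _ _)

/-- The energy is the value function. -/
theorem ExactlyObservable.valueFunction_eq (hobs : S.ExactlyObservable μ w)
    (hw : IsWhiteNoise μ w) (hQ : S.Q.PosSemidef) (hR : S.R.PosDef) (hu : IsControl μ w u)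
    {P : Fin (d + 1) → Matrix (Fin n) (Fin n) ℝ} (hP : ∀ i, (P i).PosSemidef)
    (hfix : S.riccatiMap P = P) (x0 : Fin n → ℝ) (u0 : Fin d → Fin m → ℝ) {k : ℕ} (hk : d ≤ k) :
    S.valueFunction μ w x0 u0 u k
      = ENNReal.ofReal (S.energy μ w x0 (delayedInput u0 u) P k) := by
  refine le_antisymm ?_ (le_iInf₂ fun v hv => le_iInf fun hvu => ?_)
  · obtain ⟨v, hv, hvu, hdev⟩ := hobs.exists_optimal_continuation hw hQ hR hu hP hfix x0 u0 hk
    refine (iInf₂_le v hv).trans ((iInf_le _ hvu).trans ?_)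
    rw [costFrom_eq hw hQ hR hv.1, ← energy_congr S x0 (delayedInput_congr hvu)]
    exact inputCost_le_of_deviation_eq_zero hw hQ hR (hv.1.isDelayedControl u0) hP hfix hdev
  · rw [costFrom_eq hw hQ hR hv.1, inputCost_eq hw hQ hR (hv.1.isDelayedControl u0) hP hfix
      (admissible_iff.1 hv).2, energy_congr S x0 (delayedInput_congr hvu)]
    exact le_self_add

/-- In E[x|_t' M x|_t] the left estimate may be replaced by x itself, because the right one is
already F_t-measurable. -/
theorem valueFormula_eq_energy (hw : IsWhiteNoise μ w) (hu : IsControl μ w u)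
    (P : Fin (d + 1) → Matrix (Fin n) (Fin n) ℝ) (k : ℕ) :
    S.valueFormula μ w P x0 u0 u k = S.energy μ w x0 (delayedInput u0 u) P k := by
  have hU := hu.isDelayedControl u0
  have hX2 := (traj_measurable_memLp (S := S) (x0 := x0) hw hU.undelayed k).2
  have hE2 := fun i => memLp_estimate (S := S) (x0 := x0) hw hU.undelayed k i
  have hself : ∀ (M : Matrix (Fin n) (Fin n) ℝ) (i : ℕ),
      secondMoment μ M (S.estimate μ w x0 (delayedInput u0 u) k i)
        (S.estimate μ w x0 (delayedInput u0 u) k i)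
      = secondMoment μ M (S.traj w x0 (delayedInput u0 u) k)
        (S.estimate μ w x0 (delayedInput u0 u) k i) := fun M i =>
    secondMoment_condExp_left (hw.noiseAlg_le _) stronglyMeasurable_condExp hX2 (hE2 i) M
  rw [valueFormula, energy]
  simp only [hself, state_eq_traj, predictor_eq_estimate (S := S) (u := u) k d rfl,
    fun i : Fin d => predictor_eq_estimate (S := S) (μ := μ) (w := w) (x0 := x0) (u0 := u0) (u := u)
      k i (t := (k : ℤ) - ((i : ℕ) + 1)) (by ring),
    fun i : Fin d => predictor_eq_estimate (S := S) (μ := μ) (w := w) (x0 := x0) (u0 := u0) (u := u)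
      k (i + 1) (t := (k : ℤ) - ((i : ℕ) + 1) - 1) (by push_cast; ring),
    dotProduct_add, dotProduct_sum, mulVec_sub, dotProduct_sub]
  have hint : ∀ i : Fin d, Integrable (fun ω =>
      S.traj w x0 (delayedInput u0 u) k ω ⬝ᵥ P i.castSucc *ᵥ
          S.estimate μ w x0 (delayedInput u0 u) k i ω
        - S.traj w x0 (delayedInput u0 u) k ω ⬝ᵥ P i.castSucc *ᵥ
          S.estimate μ w x0 (delayedInput u0 u) k (i + 1) ω) μ := fun i =>
    (hX2.integrable_bilin (hE2 _) _).sub (hX2.integrable_bilin (hE2 _) _)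
  rw [integral_add (hX2.integrable_bilin (hE2 _) _) (integrable_finsetSum _ fun i _ => hint i),
    integral_finsetSum _ fun i _ => hint i]
  simp only [secondMoment]
  congr 1
  exact Finset.sum_congr rfl fun i _ =>
    integral_sub (hX2.integrable_bilin (hE2 _) _) (hX2.integrable_bilin (hE2 _) _)

/-- The cost of an admissible control splits into a finite part, determined by the initial data,
and the weighted deviations from the feedback law. -/
theorem exists_cost_eq (hw : IsWhiteNoise μ w) (hQ : S.Q.PosSemidef) (hR : S.R.PosDef)
    {P : Fin (d + 1) → Matrix (Fin n) (Fin n) ℝ} (hP : ∀ i, (P i).PosSemidef)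
    (hfix : S.riccatiMap P = P) (x0 : Fin n → ℝ) (u0 : Fin d → Fin m → ℝ) :
    ∃ c : ℝ≥0∞, c ≠ ∞ ∧ ∀ v, S.Admissible μ w x0 u0 v → S.cost μ w x0 u0 v
      = c + ∑' j : ℕ, ENNReal.ofReal (S.deviation μ w x0 (delayedInput u0 v) P (d + j)) := by
  -- The zero control is just a representative: inputs acting before time `d`, and hence states up
  -- to time `d`, are the same for all controls.
  let U := delayedInput u0 (0 : ℕ → Ω → Fin m → ℝ)
  refine ⟨∑ j ∈ Finset.range d, ENNReal.ofReal (S.stage μ w x0 U j)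
    + ENNReal.ofReal (S.energy μ w x0 U P d), ?_, fun v hv => ?_⟩
  · exact ENNReal.add_ne_top.2
      ⟨ENNReal.sum_ne_top.2 fun _ _ => ENNReal.ofReal_ne_top, ENNReal.ofReal_ne_top⟩
  · have hcongr : ∀ j < d, delayedInput u0 v j = U j :=
      delayedInput_congr fun j hj => absurd hj (by omega)
    have hsplit : S.inputCost μ w x0 (delayedInput u0 v) 0
        = ∑ j ∈ Finset.range d, ENNReal.ofReal (S.stage μ w x0 (delayedInput u0 v) j)
          + S.inputCost μ w x0 (delayedInput u0 v) d := by
      simp only [inputCost, zero_add]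
      have := (ENNReal.summable (f := fun j =>
        ENNReal.ofReal (S.stage μ w x0 (delayedInput u0 v) (j + d)))).sum_add_tsum_nat_add'
        (f := fun j => ENNReal.ofReal (S.stage μ w x0 (delayedInput u0 v) j))
      rw [← this]
      simp only [add_comm d]
    rw [cost, costFrom_eq hw hQ hR hv.1, hsplit, inputCost_eq hw hQ hR
      (hv.1.isDelayedControl u0) hP hfix (admissible_iff.1 hv).2, energy_congr S x0 hcongr,
      ← add_assoc]
    congr 2
    refine Finset.sum_congr rfl fun j hj => ?_
    rw [stage_congr S x0 fun i hi => hcongr i (hi.trans_lt (Finset.mem_range.1 hj))]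

/-- Optimality is equivalent to obeying the feedback law. -/
theorem ExactlyObservable.isOptimal_iff_deviation (hobs : S.ExactlyObservable μ w)
    (hw : IsWhiteNoise μ w) (hQ : S.Q.PosSemidef) (hR : S.R.PosDef) (hu : IsControl μ w u)
    {P : Fin (d + 1) → Matrix (Fin n) (Fin n) ℝ} (hP : ∀ i, (P i).PosSemidef)
    (hfix : S.riccatiMap P = P) :
    S.IsOptimal μ w x0 u0 u
      ↔ ∀ j, S.deviation μ w x0 (delayedInput u0 u) P (d + j) = 0 := by
  obtain ⟨c, hc, hcost⟩ := exists_cost_eq hw hQ hR hP hfix x0 u0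
  constructor
  · rintro ⟨hadm, -, hmin⟩ j
    obtain ⟨v, hv, -, hdev⟩ :=
      hobs.exists_optimal_continuation hw hQ hR hu hP hfix x0 u0 le_rfl
    have h1 := hmin v hv
    rw [hcost v hv, hcost u hadm] at h1
    simp only [hdev, ENNReal.ofReal_zero, tsum_zero] at h1
    -- Finiteness of `c` permits cancelling it in [0, ∞].
    have h2 := ENNReal.tsum_eq_zero.1 (nonpos_iff_eq_zero.1 ((ENNReal.add_le_add_iff_left hc).1 h1))
    exact le_antisymm (ENNReal.ofReal_eq_zero.1 (h2 j)) (deviation_nonneg hR hP _)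
  · intro hdev
    have hU := hu.isDelayedControl u0
    have hadm : S.Admissible μ w x0 u0 u := by
      refine admissible_iff.2 ⟨hu, ?_⟩
      refine hobs.tendsto_of_inputCost_ne_top hw hQ hR hU.undelayed (k := d) ?_
      exact ne_top_of_le_ne_top ENNReal.ofReal_ne_top
        (inputCost_le_of_deviation_eq_zero hw hQ hR hU hP hfix hdev)
    have h1 : S.cost μ w x0 u0 u = c := by
      rw [hcost u hadm]
      simp [hdev]
    exact ⟨hadm, h1 ▸ hc, fun v hv => by rw [h1, hcost v hv]; exact le_self_add⟩

theorem deviation_eq_zero_iff_feedback (hw : IsWhiteNoise μ w) (hR : S.R.PosDef)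
    (hu : IsControl μ w u) {P : Fin (d + 1) → Matrix (Fin n) (Fin n) ℝ}
    (hP : ∀ i, (P i).PosSemidef) :
    (∀ j, S.deviation μ w x0 (delayedInput u0 u) P (d + j) = 0) ↔
      ∀ k, d ≤ k → u (k - d) =ᵐ[μ]
        fun ω => -(S.gain P *ᵥ S.predictor μ w x0 u0 u k ((k : ℤ) - d - 1) ω) := by
  have key : ∀ k, d ≤ k → (S.deviation μ w x0 (delayedInput u0 u) P k = 0 ↔ u (k - d) =ᵐ[μ]
        fun ω => -(S.gain P *ᵥ S.predictor μ w x0 u0 u k ((k : ℤ) - d - 1) ω)) := fun k hk => by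
    rw [deviation_eq_zero_iff hw hR (hu.isDelayedControl u0) hP, predictor_eq_estimate k d rfl]
    have : delayedInput u0 u k = u (k - d) := by simp [delayedInput, not_lt.2 hk]
    rw [this]
  constructor
  · intro h k hk
    rw [← key k hk]
    have := h (k - d)
    rwa [Nat.add_sub_cancel' hk] at this
  · intro h j
    exact (key _ (Nat.le_add_right _ _)).2 (h _ (Nat.le_add_right _ _))

theorem ExactlyObservable.uniquelySolvable (hobs : S.ExactlyObservable μ w)
    (hw : IsWhiteNoise μ w) (hQ : S.Q.PosSemidef) (hR : S.R.PosDef)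
    {P : Fin (d + 1) → Matrix (Fin n) (Fin n) ℝ} (hP : ∀ i, (P i).PosSemidef)
    (hfix : S.riccatiMap P = P) : S.UniquelySolvable d μ w := by
  intro x0 u0
  have h0 : IsControl μ w (0 : ℕ → Ω → Fin m → ℝ) := fun _ => ⟨measurable_const, MemLp.zero⟩
  obtain ⟨u, hu, -, hdev⟩ := hobs.exists_optimal_continuation hw hQ hR h0 hP hfix x0 u0 le_rfl
  refine ⟨u, (hobs.isOptimal_iff_deviation hw hQ hR hu.1 hP hfix).2 hdev, fun v hv k => ?_⟩
  have hvdev := (hobs.isOptimal_iff_deviation hw hQ hR hv.1.1 hP hfix).1 hv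
  exact eq_of_feedback ((deviation_eq_zero_iff_feedback hw hR hu.1 hP).1 hdev)
    ((deviation_eq_zero_iff_feedback hw hR hv.1.1 hP).1 hvdev) k

/-- Unique solvability yields a positive semidefinite fixed point of the Riccati operator. -/
theorem UniquelySolvable.exists_fixedPoint (hsol : S.UniquelySolvable d μ w) (hd : 0 < d)
    (hw : IsWhiteNoise μ w) (hQ : S.Q.PosSemidef) (hR : S.R.PosDef) :
    ∃ P : Fin (d + 1) → Matrix (Fin n) (Fin n) ℝ,
      (∀ i, (P i).PosSemidef) ∧ S.riccatiMap P = P := by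
  refine exists_fixedPoint_of_bounded hQ hR (riccatiIter_bounded (μ := μ) (w := w) hd hw hQ hR
    fun x0 => ?_)
  -- Zero initial inputs, together with `0 < d`, make the input acting at time 0 vanish.
  obtain ⟨u, ⟨hadm, hfin, -⟩, -⟩ := hsol x0 0
  refine ⟨delayedInput 0 u, hadm.1.isDelayedControl 0, ?_, ?_⟩
  · simp only [delayedInput, hd, dif_pos]
    rfl
  · rwa [cost, costFrom_eq hw hQ hR hadm.1] at hfin

end LQRData

theorem lemma2 {n m d : ℕ} (hd : 0 < d) {Ω : Type*} [MeasurableSpace Ω] (μ : Measure Ω)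
    [IsProbabilityMeasure μ] (w : ℕ → Ω → ℝ) (hw : IsWhiteNoise μ w)
    (S : LQRData n m) (hQ : S.Q.PosSemidef) (hR : S.R.PosDef)
    (hobs : S.ExactlyObservable μ w) :
    (S.UniquelySolvable d μ w ↔
      ∃! P : Fin (d + 1) → Matrix (Fin n) (Fin n) ℝ, S.IsRiccatiSolution P) ∧
    ∀ P : Fin (d + 1) → Matrix (Fin n) (Fin n) ℝ, S.IsRiccatiSolution P →
      ∀ (x0 : Fin n → ℝ) (u0 : Fin d → Fin m → ℝ) (u : ℕ → Ω → Fin m → ℝ),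
        LQRData.IsControl μ w u →
        (S.IsOptimal μ w x0 u0 u ↔
          ∀ k, d ≤ k → u (k - d) =ᵐ[μ]
            fun ω => -(S.gain P *ᵥ S.predictor μ w x0 u0 u k ((k : ℤ) - d - 1) ω)) ∧
        ∀ k, d ≤ k →
          S.valueFunction μ w x0 u0 u k ≠ ∞ ∧
          (S.valueFunction μ w x0 u0 u k).toReal = S.valueFormula μ w P x0 u0 u k := by
  have hpsd : ∀ {P : Fin (d + 1) → Matrix (Fin n) (Fin n) ℝ}, S.IsRiccatiSolution P →
      (∀ i, (P i).PosSemidef) ∧ S.riccatiMap P = P := fun h =>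
    ⟨fun i => (h.posDef i).posSemidef, ((LQRData.isRiccatiSolution_iff S _).1 h).2⟩
  refine ⟨⟨fun hsol => ?_, fun ⟨P, hP, _⟩ => ?_⟩, fun P hP x0 u0 u hu => ⟨?_, fun k hk => ?_⟩⟩
  · obtain ⟨P, hP, hfix⟩ := hsol.exists_fixedPoint hd hw hQ hR
    refine ⟨P, (LQRData.isRiccatiSolution_iff S P).2
      ⟨hobs.posDef_of_fixedPoint hw hQ hR hP hfix, hfix⟩, fun P' hP' => ?_⟩
    exact hobs.riccati_unique hd hw hQ hR (hpsd hP').1 (hpsd hP').2 hP hfix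
  · exact hobs.uniquelySolvable hw hQ hR (hpsd hP).1 (hpsd hP).2
  · rw [hobs.isOptimal_iff_deviation hw hQ hR hu (hpsd hP).1 (hpsd hP).2,
      LQRData.deviation_eq_zero_iff_feedback hw hR hu (hpsd hP).1]
  · have hV := hobs.valueFunction_eq hw hQ hR hu (hpsd hP).1 (hpsd hP).2 x0 u0 hk
    rw [hV, LQRData.valueFormula_eq_energy hw hu]
    exact ⟨ENNReal.ofReal_ne_top, ENNReal.toReal_ofReal
      (LQRData.energy_nonneg hw (hu.isDelayedControl u0) (hpsd hP).1 k)⟩
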